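/- **Setting.** Basic types are integer, Boolean, object and possibly others, with fixed domains; the domain of objects is infinite and contains the void reference $\mathbf{null}$. Expressions are built from simple and array variables, constants, operations, equality, Boolean connectives and conditional expressions; objects can only be compared for equality. *Object-oriented programs* are built from $skip$, assignments $u:=t$ (with $u$ a simple or subscripted, normal or instance variable), parallel assignments $\bar x:=\bar t$, $S_1;S_2$, $\mathbf{if}\ B\ \mathbf{then}\ S_1\ \mathbf{else}\ S_2\ \mathbf{fi}$, failure statements $\mathbf{if}\ B\to S\ \mathbf{fi}$ (which fail if $B$ is false), $\mathbf{while}\ B\ \mathbf{do}\ S\ \mathbf{od}$, blocks $\mathbf{begin\ local}\ \bar x:=\bar t;\,S\ \mathbf{end}$ and method calls $s.m(\bar t)$, relative to a set $D$ of declarations $m(\bar u)::S$ containing every called method; the normal variable $\mathbf{this}$ denotes the current object, is never assigned to or declared local in a program, and an instance variable $u$ abbreviates $\mathbf{this}.u$ (so it involves the variable $\mathbf{this}$). *Recursive programs* have procedure calls $P(\bar t)$, with declarations $P(\bar u)::S$ and call-by-value parameters, instead of method calls, and no instance variables. Assertions are built from Boolean expressions by connectives and quantification over simple normal variables; for object-oriented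 programs they may also use navigation expressions $e.x$ and $e.a[\bar s]$ for instance variables $x$, $a$. **Translation.** $\Theta$ turns an instance variable $x$ of type $T$ (array $a$ of type $T_1\times\dots\times T_n\to T$) into a normal array variable of type $\mathbf{object}\to T$ (of type $\mathbf{object}\times T_1\times\dots\times T_n\to T$), with $\Theta(x)=x[\mathbf{this}]$, $\Theta(a[\bar s])=a[\mathbf{this},\Theta(\bar s)]$, $\Theta(e.x)=x[\Theta(e)]$, $\Theta(e.a[\bar s])=a[\Theta(e),\Theta(\bar s)]$, and $\Theta(s.m(\bar t))=\mathbf{if}\ \Theta(s)\neq\mathbf{null}\to m(\Theta(s),\Theta(\bar t))\ \mathbf{fi}$; it commutes with all other constructs of expressions, assertions and statements, and $\Theta(D)=\{m(\mathbf{this},\bar u)::\Theta(S)\mid m(\bar u)::S\in D\}$. **Proof systems.** All systems contain the axioms and rules: skip $\{p\}\,skip\,\{p\}$; assignment $\{p[u:=t]\}\,u:=t\,\{p\}$ (for the object-oriented systems also for instance variables $u$, where the substitution replaces $e.u$ by $\mathbf{if}\ e[u:=t]=\mathbf{this}\ \mathbf{then}\ t\ \mathbf{else}\ e[u:=t].u\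 \mathbf{fi}$, and similarly for subscripted variables); parallel assignment; composition; conditional; loop; consequence (with implications true in all states); block (from $\{p\}\,\bar x:=\bar t;S\,\{q\}$ infer $\{p\}\,\mathbf{begin\ local}\ \bar x:=\bar t;S\ \mathbf{end}\,\{q\}$ if no $x_i$ is free in $q$); disjunction; conjunction; $\exists$-introduction (from $\{p\}S\{q\}$ infer $\{\exists x:p\}S\{q\}$ if $x\notin var(D)\cup var(S)\cup free(q)$); invariance (from $\{r\}S\{q\}$ infer $\{p\wedge r\}S\{p\wedge q\}$ if $free(p)\cap(change(D)\cup change(S))=\emptyset$); substitution (from $\{p\}S\{q\}$ infer $\{p[\bar z:=\bar t]\}S\{q[\bar z:=\bar t]\}$ for distinct simple normal variables $\bar z$ with $\{\bar z\}\cap(var(D)\cup var(S))=var(\bar t)\cap(change(D)\cup change(S))=\emptyset$). Here $var$ and $change$ give the variables that occur, and the global variables that can be modified, and $\mathbf{this}$ counts as an implicit formal parameter of every method. PR and PO add the failure rule: from $\{p\wedge B\}S\{q\}$ infer $\{p\}\,\mathbf{if}\ B\to S\ \mathbf{fi}\,\{q\}$. SPR and SPO add instead: from $p\to B$ and $\{p\}S\{q\}$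 infer $\{p\}\,\mathbf{if}\ B\to S\ \mathbf{fi}\,\{q\}$. PO moreover has the weakening rule: from $\{p\wedge s\neq\mathbf{null}\}\,s.m(\bar t)\,\{q\}$ infer $\{p\}\,s.m(\bar t)\,\{q\}$. PR$^+$, SPR$^+$, PO$^+$, SPO$^+$ extend PR, SPR, PO, SPO by a recursion rule. For PR$^+$ and SPR$^+$: if, for a finite list of assumptions $A=\{p_i\}P_i(\bar t_i)\{q_i\}$ $(i=1,\dots,n)$ with $P_i(\bar u_i)::S_i$ declared, both $A\vdash\{p\}S\{q\}$ and $A\vdash\{p_i\}\,\mathbf{begin\ local}\ \bar u_i:=\bar t_i;S_i\ \mathbf{end}\,\{q_i\}$ for all $i$, then infer $\{p\}S\{q\}$, where $\vdash$ is derivability in PR, SPR respectively. For PO$^+$ and SPO$^+$ the assumptions are $\{p_i\}s_i.m_i(\bar t_i)\{q_i\}$, the blocks are $\mathbf{begin\ local}\ \mathbf{this},\bar u_i:=s_i,\bar t_i;S_i\ \mathbf{end}$, and $\vdash$ is derivability in PO, SPO respectively; SPO$^+$ additionally requires $p_i\to s_i\neq\mathbf{null}$ for all $i$. **Theorem (Translation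 II).** Let $D$ be a set of method declarations. For all assertions $p,q$ and all object-oriented programs $S$ in the context of $D$: 1. $\{p\}S\{q\}$ is derivable in PO$^+$ (relative to $D$) iff $\{\Theta(p)\}\Theta(S)\{\Theta(q)\}$ is derivable in PR$^+$ (relative to $\Theta(D)$); 2. $\{p\}S\{q\}$ is derivable in SPO$^+$ iff $\{\Theta(p)\}\Theta(S)\{\Theta(q)\}$ is derivable in SPR$^+$. Consequently: 3. for every set $\mathcal C$ of object-oriented programs in the context of $D$, PO$^+$ is sound (resp. relatively complete) for partial correctness of the programs in $\mathcal C$ iff PR$^+$ is sound (resp. relatively complete) for partial correctness of the programs $\Theta(S)$, $S\in\mathcal C$, with respect to all assertions of the recursive language; the same holds for SPO$^+$, SPR$^+$ and strong partial correctness (partial correctness together with absence of failures). -/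

import Mathlib

noncomputable section
open scoped Classical

namespace OOVerif

/-! ### Types, signatures, interpretation -/

/-- Basic types: integer, Boolean, object, and possibly further ones. -/
inductive Ty (B : Type) : Type
  | int : Ty B
  | bool : Ty B
  | obj : Ty B
  | base (b : B) : Ty B

/-- The domain of values of each basic type. -/
@[reducible] def Ty.Dom {B : Type} (D : B → Type) (O : Type) : Ty B → Type
  | .int => ℤ
  | .bool => Bool
  | .obj => O
  | .base b => D b

/-- Sequences of `F`-entities of the types listed in `ts`. -/
abbrev Tup {B : Type} (F : Ty B → Type) (ts : List (Ty B)) : Type :=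
  (i : Fin ts.length) → F (ts.get i)

def Tup.nil {B : Type} {F : Ty B → Type} : Tup F [] := fun i => i.elim0

def Tup.cons {B : Type} {F : Ty B → Type} {T : Ty B} {ts : List (Ty B)}
    (x : F T) (s : Tup F ts) : Tup F (T :: ts) :=
  Fin.cons (α := fun i : Fin (ts.length + 1) => F ((T :: ts).get i)) x s

/-- The part that object-oriented and recursive programs share: basic types and their domains,
the infinite set of objects with the void reference `null`, typed constants (operation symbols
without arguments) and operations with their fixed interpretation, and the simple normal variables.
Equality on every basic type, the Boolean connectives, `null` and conditional expressions are built
into the expressions below; no other operation involves the type of objects. -/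
structure Sig where
  Base : Type
  BaseDom : Base → Type
  baseDom_nonempty : ∀ b, Nonempty (BaseDom b)
  Obj : Type
  obj_infinite : Infinite Obj
  null : Obj
  Fn : List (Ty Base) → Ty Base → Type
  fn_not_obj : ∀ {ts T}, Fn ts T → Ty.obj ∉ ts ∧ T ≠ Ty.obj
  fn : ∀ {ts T}, Fn ts T → Tup (Ty.Dom BaseDom Obj) ts → Ty.Dom BaseDom Obj T
  Var : Ty Base → Type
  var_infinite : ∀ T, Infinite (Var T)

abbrev Sig.Typ (Sg : Sig) : Type := Ty Sg.Base

abbrev Sig.Dom (Sg : Sig) : Sg.Typ → Type := Ty.Dom Sg.BaseDom Sg.Obj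

/-- Simple normal variables together with their types. -/
abbrev Sig.AnyVar (Sg : Sig) : Type := Σ T : Sg.Typ, Sg.Var T

/-- The variables of a sequence are pairwise distinct. -/
def Distinct {Sg : Sig} {ts : List Sg.Typ} (x : Tup Sg.Var ts) : Prop :=
  Function.Injective fun i => (⟨ts.get i, x i⟩ : Sg.AnyVar)

/-- The simple variable `z` is a member of the sequence `x`. -/
def MemTup {Sg : Sig} {ts : List Sg.Typ} {T : Sg.Typ} (z : Sg.Var T) (x : Tup Sg.Var ts) : Prop :=
  ∃ i, (⟨ts.get i, x i⟩ : Sg.AnyVar) = ⟨T, z⟩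

/-- The assignment `f` of `F`-entities to simple variables, changed to `v` at `x`. -/
def bindOne {Sg : Sig} {F : Sg.Typ → Type} {T : Sg.Typ} (x : Sg.Var T) (v : F T)
    (f : ∀ ⦃U : Sg.Typ⦄, Sg.Var U → F U) : ∀ ⦃U : Sg.Typ⦄, Sg.Var U → F U :=
  fun U y =>
    if h : (⟨T, x⟩ : Sg.AnyVar) = ⟨U, y⟩ then cast (congrArg (fun z : Sg.AnyVar => F z.1) h) v
    else f y

/-- The assignment `f` of `F`-entities to simple variables, changed simultaneously to `v i`
at `x i`, for all `i`. -/
def bindMany {Sg : Sig} {F : Sg.Typ → Type} {ts : List Sg.Typ} (x : Tup Sg.Var ts) (v : Tup F ts)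
    (f : ∀ ⦃U : Sg.Typ⦄, Sg.Var U → F U) : ∀ ⦃U : Sg.Typ⦄, Sg.Var U → F U :=
  fun U y =>
    if h : ∃ i, (⟨ts.get i, x i⟩ : Sg.AnyVar) = ⟨U, y⟩ then
      cast (congrArg (fun z : Sg.AnyVar => F z.1) h.choose_spec) (v h.choose)
    else f y

/-- Partial correctness and strong partial correctness. -/
inductive Mode : Type
  | pc : Mode
  | spc : Mode

/-! ### Object-oriented programs: syntax -/

/-- The vocabulary of object-oriented programs: the normal object variable `this`, normal array
variables, simple and array instance variables, and method identifiers (indexed by the types of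
their parameters). Array variables have at least one argument. -/
structure Lang (Sg : Sig) where
  this : Sg.Var Ty.obj
  Arr : List Sg.Typ → Sg.Typ → Type
  arr_nil : ∀ T, IsEmpty (Arr [] T)
  IVar : Sg.Typ → Type
  IArr : List Sg.Typ → Sg.Typ → Type
  iarr_nil : ∀ T, IsEmpty (IArr [] T)
  Meth : List Sg.Typ → Type

/-- `prog` marks the expressions of the programming language, `glob` the global expressions. -/
inductive Scope : Type
  | prog : Scope
  | glob : Scope

/-- Expressions. The last two clauses are the navigation expressions `e.x` and `e.a[s₁,…,sₙ]`;
they are available in global expressions only. -/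
inductive Expr {Sg : Sig} (L : Lang Sg) : Scope → Sg.Typ → Type
  | var {g : Scope} {T : Sg.Typ} (x : Sg.Var T) : Expr L g T
  | arr {g : Scope} {ts : List Sg.Typ} {T : Sg.Typ} (a : L.Arr ts T)
      (s : (i : Fin ts.length) → Expr L g (ts.get i)) : Expr L g T
  | inst {g : Scope} {T : Sg.Typ} (x : L.IVar T) : Expr L g T
  | instArr {g : Scope} {ts : List Sg.Typ} {T : Sg.Typ} (a : L.IArr ts T)
      (s : (i : Fin ts.length) → Expr L g (ts.get i)) : Expr L g T
  | null {g : Scope} : Expr L g Ty.obj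
  | tt {g : Scope} : Expr L g Ty.bool
  | not {g : Scope} (b : Expr L g Ty.bool) : Expr L g Ty.bool
  | and {g : Scope} (b c : Expr L g Ty.bool) : Expr L g Ty.bool
  | eq {g : Scope} {T : Sg.Typ} (s t : Expr L g T) : Expr L g Ty.bool
  | cond {g : Scope} {T : Sg.Typ} (b : Expr L g Ty.bool) (s t : Expr L g T) : Expr L g T
  | fn {g : Scope} {ts : List Sg.Typ} {T : Sg.Typ} (f : Sg.Fn ts T)
      (s : (i : Fin ts.length) → Expr L g (ts.get i)) : Expr L g T
  | nav {T : Sg.Typ} (e : Expr L Scope.glob Ty.obj) (x : L.IVar T) : Expr L Scope.glob T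
  | navArr {ts : List Sg.Typ} {T : Sg.Typ} (e : Expr L Scope.glob Ty.obj) (a : L.IArr ts T)
      (s : (i : Fin ts.length) → Expr L Scope.glob (ts.get i)) : Expr L Scope.glob T

/-- Assertions: global Boolean expressions closed under connectives and quantification over
simple normal variables. -/
inductive Assn {Sg : Sig} (L : Lang Sg) : Type
  | atom (b : Expr L Scope.glob Ty.bool) : Assn L
  | not (p : Assn L) : Assn L
  | and (p q : Assn L) : Assn L
  | or (p q : Assn L) : Assn L
  | ex {T : Sg.Typ} (x : Sg.Var T) (p : Assn L) : Assn L
  | all {T : Sg.Typ} (x : Sg.Var T) (p : Assn L) : Assn L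

/-- Left-hand sides of assignments: simple or subscripted, normal or instance variables. -/
inductive Loc {Sg : Sig} (L : Lang Sg) : Sg.Typ → Type
  | var {T : Sg.Typ} (x : Sg.Var T) : Loc L T
  | arr {ts : List Sg.Typ} {T : Sg.Typ} (a : L.Arr ts T) (s : Tup (Expr L Scope.prog) ts) : Loc L T
  | inst {T : Sg.Typ} (x : L.IVar T) : Loc L T
  | instArr {ts : List Sg.Typ} {T : Sg.Typ} (a : L.IArr ts T) (s : Tup (Expr L Scope.prog) ts) :
      Loc L T

/-- Statements. `fail B S` is the failure statement `if B → S fi`, `block x t S` is the block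
statement `begin local x := t; S end`, and `call s m t` is the method call `s.m(t)`. -/
inductive Stmt {Sg : Sig} (L : Lang Sg) : Type
  | skip : Stmt L
  | assign {T : Sg.Typ} (u : Loc L T) (t : Expr L Scope.prog T) : Stmt L
  | passign {ts : List Sg.Typ} (x : Tup Sg.Var ts) (t : Tup (Expr L Scope.prog) ts) : Stmt L
  | seq (S₁ S₂ : Stmt L) : Stmt L
  | ite (B : Expr L Scope.prog Ty.bool) (S₁ S₂ : Stmt L) : Stmt L
  | fail (B : Expr L Scope.prog Ty.bool) (S : Stmt L) : Stmt L
  | while (B : Expr L Scope.prog Ty.bool) (S : Stmt L) : Stmt L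
  | block {ts : List Sg.Typ} (x : Tup Sg.Var ts) (t : Tup (Expr L Scope.prog) ts) (S : Stmt L) :
      Stmt L
  | call {ts : List Sg.Typ} (s : Expr L Scope.prog Ty.obj) (m : L.Meth ts)
      (t : Tup (Expr L Scope.prog) ts) : Stmt L

/-- A method declaration `m(u₁,…,uₙ) :: S`, without the name of the method. -/
structure Decl {Sg : Sig} (L : Lang Sg) (ts : List Sg.Typ) where
  formals : Tup Sg.Var ts
  body : Stmt L

/-- A set of method declarations: each method has at most one declaration. -/
abbrev Decls {Sg : Sig} (L : Lang Sg) : Type :=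
  ∀ ⦃ts : List Sg.Typ⦄, L.Meth ts → Option (Decl L ts)

/-- The correctness formula `{pre} stmt {post}`. -/
structure Formula {Sg : Sig} (L : Lang Sg) where
  pre : Assn L
  stmt : Stmt L
  post : Assn L

section OO

variable {Sg : Sig} {L : Lang Sg}

/-- The sequence of local variables of a block, or the left-hand side of a parallel assignment:
non-empty, pairwise distinct, and without `this`. -/
def AssignableTup (L : Lang Sg) {ts : List Sg.Typ} (x : Tup Sg.Var ts) : Prop :=
  ts ≠ [] ∧ Distinct x ∧ ¬ MemTup L.this x

/-- `S` is an object-oriented program in the context of `D`: all methods it calls are declared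
in `D`, `this` is neither assigned to nor used as a local variable, and the variables of every
parallel assignment and of every block are distinct. -/
def Stmt.IsProgram (D : Decls L) : Stmt L → Prop
  | .skip => True
  | .assign (T := T) (.var x) _ => (⟨T, x⟩ : Sg.AnyVar) ≠ ⟨Ty.obj, L.this⟩
  | .assign _ _ => True
  | .passign x _ => AssignableTup L x
  | .seq S₁ S₂ => S₁.IsProgram D ∧ S₂.IsProgram D
  | .ite _ S₁ S₂ => S₁.IsProgram D ∧ S₂.IsProgram D
  | .fail _ S => S.IsProgram D
  | .while _ S => S.IsProgram D
  | .block x _ S => AssignableTup L x ∧ S.IsProgram D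
  | .call _ m _ => (D m).isSome = true

/-- The declarations in `D` are well-formed: the formal parameters of each method are distinct and
do not include `this`, and the bodies are object-oriented programs in the context of `D`. -/
def Decls.WellFormed (D : Decls L) : Prop :=
  ∀ ⦃ts : List Sg.Typ⦄ (m : L.Meth ts) (d : Decl L ts), D m = some d →
    Distinct d.formals ∧ ¬ MemTup L.this d.formals ∧ d.body.IsProgram D

/-- Every expression of the programming language is a global expression. -/
def Expr.toGlob {g : Scope} {T : Sg.Typ} : Expr L g T → Expr L Scope.glob T
  | .var x => .var x
  | .arr a s => .arr a fun i => (s i).toGlob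
  | .inst x => .inst x
  | .instArr a s => .instArr a fun i => (s i).toGlob
  | .null => .null
  | .tt => .tt
  | .not b => .not b.toGlob
  | .and b c => .and b.toGlob c.toGlob
  | .eq s t => .eq s.toGlob t.toGlob
  | .cond b s t => .cond b.toGlob s.toGlob t.toGlob
  | .fn f s => .fn f fun i => (s i).toGlob
  | .nav e x => .nav e x
  | .navArr e a s => .navArr e a s

/-- The conjunction of a list of Boolean expressions. -/
def Expr.bigAnd {g : Scope} : List (Expr L g Ty.bool) → Expr L g Ty.bool
  | [] => .tt
  | [b] => b
  | b :: c :: bs => .and b (Expr.bigAnd (c :: bs))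

/-- A Boolean expression of the programming language as an assertion. -/
def Assn.ofExpr (B : Expr L Scope.prog Ty.bool) : Assn L := .atom B.toGlob

/-- The Boolean expression `s ≠ null`. -/
def Expr.neNull (s : Expr L Scope.prog Ty.obj) : Expr L Scope.prog Ty.bool := .not (.eq s .null)

/-- The block statement `begin local this, u := s, t; S end` that a call `s.m(t)` amounts to,
where `m(u) :: S` is the declaration of `m`. -/
def Decl.inline {ts : List Sg.Typ} (d : Decl L ts) (s : Expr L Scope.prog Ty.obj)
    (t : Tup (Expr L Scope.prog) ts) : Stmt L :=
  .block (Tup.cons (F := Sg.Var) L.this d.formals) (Tup.cons (F := Expr L Scope.prog) s t) d.body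

/-! ### Object-oriented programs: semantics -/

/-- The local state of an object. -/
structure LocalState {Sg : Sig} (L : Lang Sg) where
  var : ∀ ⦃T : Sg.Typ⦄, L.IVar T → Sg.Dom T
  arr : ∀ ⦃ts : List Sg.Typ⦄ ⦃T : Sg.Typ⦄, L.IArr ts T → Tup Sg.Dom ts → Sg.Dom T

/-- Proper states: values of the normal variables, and a local state for each object. -/
structure State {Sg : Sig} (L : Lang Sg) where
  var : ∀ ⦃T : Sg.Typ⦄, Sg.Var T → Sg.Dom T
  arr : ∀ ⦃ts : List Sg.Typ⦄ ⦃T : Sg.Typ⦄, L.Arr ts T → Tup Sg.Dom ts → Sg.Dom T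
  heap : Sg.Obj → LocalState L

/-- The value of an expression in a state; instance variables are those of the current object. -/
def Expr.eval (σ : State L) {g : Scope} {T : Sg.Typ} : Expr L g T → Sg.Dom T
  | .var x => σ.var x
  | .arr a s => σ.arr a fun i => (s i).eval σ
  | .inst x => (σ.heap (σ.var L.this)).var x
  | .instArr a s => (σ.heap (σ.var L.this)).arr a fun i => (s i).eval σ
  | .null => Sg.null
  | .tt => true
  | .not b => Bool.not (b.eval σ)
  | .and b c => Bool.and (b.eval σ) (c.eval σ)
  | .eq s t => decide (s.eval σ = t.eval σ)
  | .cond b s t => if b.eval σ = true then s.eval σ else t.eval σ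
  | .fn f s => Sg.fn f fun i => (s i).eval σ
  | .nav e x => (σ.heap (e.eval σ)).var x
  | .navArr e a s => (σ.heap (e.eval σ)).arr a fun i => (s i).eval σ

/-- The Boolean expression `B` is true in `σ`. -/
def Expr.IsTrue {g : Scope} (B : Expr L g Ty.bool) (σ : State L) : Prop :=
  B.eval σ = true

/-- The update of a simple normal variable. -/
def State.setVar (σ : State L) {T : Sg.Typ} (x : Sg.Var T) (d : Sg.Dom T) : State L :=
  { σ with var := bindOne (F := Sg.Dom) x d σ.var }

/-- The parallel update of a sequence of simple normal variables. -/
def State.setVars (σ : State L) {ts : List Sg.Typ} (x : Tup Sg.Var ts) (d : Tup Sg.Dom ts) :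
    State L :=
  { σ with var := bindMany (F := Sg.Dom) x d σ.var }

/-- The update of a family `f` of interpretations of array variables: the value of the array `a`
at `v` becomes `d`. -/
def updArr {Sg : Sig} {A : List Sg.Typ → Sg.Typ → Type}
    (f : ∀ ⦃ts : List Sg.Typ⦄ ⦃T : Sg.Typ⦄, A ts T → Tup Sg.Dom ts → Sg.Dom T)
    {ts : List Sg.Typ} {T : Sg.Typ} (a : A ts T) (v : Tup Sg.Dom ts) (d : Sg.Dom T) :
    ∀ ⦃us : List Sg.Typ⦄ ⦃U : Sg.Typ⦄, A us U → Tup Sg.Dom us → Sg.Dom U :=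
  fun us U b w =>
    if h : (⟨ts, T, a⟩ : Σ us : List Sg.Typ, Σ U : Sg.Typ, A us U) = ⟨us, U, b⟩ then
      if cast (congrArg (fun z : (Σ us : List Sg.Typ, Σ U : Sg.Typ, A us U) =>
          Tup Sg.Dom z.1) h) v = w then
        cast (congrArg (fun z : (Σ us : List Sg.Typ, Σ U : Sg.Typ, A us U) => Sg.Dom z.2.1) h) d
      else f b w
    else f b w

/-- The update of a local state at a simple instance variable. -/
def LocalState.setVar (τ : LocalState L) {T : Sg.Typ} (x : L.IVar T) (d : Sg.Dom T) :
    LocalState L :=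
  { τ with var := fun U y =>
      if h : (⟨T, x⟩ : Σ U : Sg.Typ, L.IVar U) = ⟨U, y⟩ then
        cast (congrArg (fun z : (Σ U : Sg.Typ, L.IVar U) => Sg.Dom z.1) h) d
      else τ.var y }

/-- The update of a local state at an instance array variable. -/
def LocalState.setArr (τ : LocalState L) {ts : List Sg.Typ} {T : Sg.Typ} (a : L.IArr ts T)
    (v : Tup Sg.Dom ts) (d : Sg.Dom T) : LocalState L :=
  { τ with arr := updArr (A := L.IArr) τ.arr a v d }

/-- The state update `σ[o := τ]` that replaces the local state of the object `o`. -/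
def State.setLocal (σ : State L) (o : Sg.Obj) (τ : LocalState L) : State L where
  var := σ.var
  arr := σ.arr
  heap := fun o' => if o' = o then τ else σ.heap o'

/-- The state update `σ[u := d]`. For an instance variable `u` it changes the local state of the
current object. -/
def State.set (σ : State L) {T : Sg.Typ} : Loc L T → Sg.Dom T → State L
  | .var x, d => σ.setVar x d
  | .arr a s, d => { σ with arr := updArr (A := L.Arr) σ.arr a (fun i => (s i).eval σ) d }
  | .inst x, d => σ.setLocal (σ.var L.this) ((σ.heap (σ.var L.this)).setVar x d)
  | .instArr a s, d =>
      σ.setLocal (σ.var L.this)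
        ((σ.heap (σ.var L.this)).setArr a (fun i => (s i).eval σ) d)

/-- `Exec D S σ r`: started in the proper state `σ`, the statement `S` has a terminating
computation with final state `r`, where `none` is the state `fail`. -/
inductive Exec (D : Decls L) : Stmt L → State L → Option (State L) → Prop
  | skip (σ : State L) : Exec D .skip σ (some σ)
  | assign (σ : State L) {T : Sg.Typ} (u : Loc L T) (t : Expr L Scope.prog T) :
      Exec D (.assign u t) σ (some (σ.set u (t.eval σ)))
  | passign (σ : State L) {ts : List Sg.Typ} (x : Tup Sg.Var ts) (t : Tup (Expr L Scope.prog) ts) :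
      Exec D (.passign x t) σ (some (σ.setVars x fun i => (t i).eval σ))
  | seq {S₁ S₂ : Stmt L} {σ τ : State L} {r : Option (State L)} :
      Exec D S₁ σ (some τ) → Exec D S₂ τ r → Exec D (.seq S₁ S₂) σ r
  | seq_fail {S₁ S₂ : Stmt L} {σ : State L} :
      Exec D S₁ σ none → Exec D (.seq S₁ S₂) σ none
  | ite_true {B : Expr L Scope.prog Ty.bool} {S₁ S₂ : Stmt L} {σ : State L}
      {r : Option (State L)} : B.IsTrue σ → Exec D S₁ σ r → Exec D (.ite B S₁ S₂) σ r
  | ite_false {B : Expr L Scope.prog Ty.bool} {S₁ S₂ : Stmt L} {σ : State L}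
      {r : Option (State L)} : ¬ B.IsTrue σ → Exec D S₂ σ r → Exec D (.ite B S₁ S₂) σ r
  | fail_true {B : Expr L Scope.prog Ty.bool} {S : Stmt L} {σ : State L}
      {r : Option (State L)} : B.IsTrue σ → Exec D S σ r → Exec D (.fail B S) σ r
  | fail_false {B : Expr L Scope.prog Ty.bool} {S : Stmt L} {σ : State L} :
      ¬ B.IsTrue σ → Exec D (.fail B S) σ none
  | while_true {B : Expr L Scope.prog Ty.bool} {S : Stmt L} {σ : State L}
      {r : Option (State L)} : B.IsTrue σ → Exec D (.seq S (.while B S)) σ r →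
      Exec D (.while B S) σ r
  | while_false {B : Expr L Scope.prog Ty.bool} {S : Stmt L} {σ : State L} :
      ¬ B.IsTrue σ → Exec D (.while B S) σ (some σ)
  | block {ts : List Sg.Typ} {x : Tup Sg.Var ts} {t : Tup (Expr L Scope.prog) ts} {S : Stmt L}
      {σ τ : State L} : Exec D (.seq (.passign x t) S) σ (some τ) →
      Exec D (.block x t S) σ (some (τ.setVars x fun i => σ.var (x i)))
  | block_fail {ts : List Sg.Typ} {x : Tup Sg.Var ts} {t : Tup (Expr L Scope.prog) ts}
      {S : Stmt L} {σ : State L} : Exec D (.seq (.passign x t) S) σ none →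
      Exec D (.block x t S) σ none
  | call {ts : List Sg.Typ} {s : Expr L Scope.prog Ty.obj} {m : L.Meth ts}
      {t : Tup (Expr L Scope.prog) ts} {d : Decl L ts} {σ : State L} {r : Option (State L)} :
      D m = some d → Exec D (.fail s.neNull (d.inline s t)) σ r → Exec D (.call s m t) σ r

/-- Satisfaction of an assertion in a proper state. -/
def Assn.Sat : State L → Assn L → Prop
  | σ, .atom b => b.IsTrue σ
  | σ, .not p => ¬ p.Sat σ
  | σ, .and p q => p.Sat σ ∧ q.Sat σ
  | σ, .or p q => p.Sat σ ∨ q.Sat σ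
  | σ, .ex (T := T) x p => ∃ d : Sg.Dom T, p.Sat (σ.setVar x d)
  | σ, .all (T := T) x p => ∀ d : Sg.Dom T, p.Sat (σ.setVar x d)

/-- The implication `p → q` is true in all proper states. -/
def Assn.Implies (p q : Assn L) : Prop := ∀ σ : State L, p.Sat σ → q.Sat σ

/-- Truth of the correctness formula `{p} S {q}`, in the sense of partial correctness or
of strong partial correctness. -/
def Valid (D : Decls L) : Mode → Assn L → Stmt L → Assn L → Prop
  | .pc, p, S, q => ∀ σ τ : State L, p.Sat σ → Exec D S σ (some τ) → q.Sat τ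
  | .spc, p, S, q => ∀ (σ : State L) (r : Option (State L)), p.Sat σ → Exec D S σ r →
      ∃ τ, r = some τ ∧ q.Sat τ

/-! ### Object-oriented programs: variables -/

/-- Variables of all kinds. -/
inductive AnyVar {Sg : Sig} (L : Lang Sg) : Type
  | var {T : Sg.Typ} (x : Sg.Var T) : AnyVar L
  | arr {ts : List Sg.Typ} {T : Sg.Typ} (a : L.Arr ts T) : AnyVar L
  | inst {T : Sg.Typ} (x : L.IVar T) : AnyVar L
  | instArr {ts : List Sg.Typ} {T : Sg.Typ} (a : L.IArr ts T) : AnyVar L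

/-- The set of variables of a sequence. -/
def tupVars (L : Lang Sg) {ts : List Sg.Typ} (x : Tup Sg.Var ts) : Set (AnyVar L) :=
  Set.range fun i => AnyVar.var (x i)

/-- The variables of an expression. An instance variable `u` is an abbreviation of `this.u`,
so it involves the variable `this` as well. -/
def Expr.vars {g : Scope} {T : Sg.Typ} : Expr L g T → Set (AnyVar L)
  | .var x => {.var x}
  | .arr a s => {.arr a} ∪ ⋃ i, (s i).vars
  | .inst x => {.var L.this, .inst x}
  | .instArr a s => {.var L.this, .instArr a} ∪ ⋃ i, (s i).vars
  | .null => ∅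
  | .tt => ∅
  | .not b => b.vars
  | .and b c => b.vars ∪ c.vars
  | .eq s t => s.vars ∪ t.vars
  | .cond b s t => b.vars ∪ s.vars ∪ t.vars
  | .fn _ s => ⋃ i, (s i).vars
  | .nav e x => {.inst x} ∪ e.vars
  | .navArr e a s => {.instArr a} ∪ e.vars ∪ ⋃ i, (s i).vars

/-- The free variables of an assertion. -/
def Assn.free : Assn L → Set (AnyVar L)
  | .atom b => b.vars
  | .not p => p.free
  | .and p q => p.free ∪ q.free
  | .or p q => p.free ∪ q.free
  | .ex x p => p.free \ {.var x}
  | .all x p => p.free \ {.var x}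

/-- The variables of a left-hand side. -/
def Loc.vars {T : Sg.Typ} : Loc L T → Set (AnyVar L)
  | .var x => {.var x}
  | .arr a s => {.arr a} ∪ ⋃ i, (s i).vars
  | .inst x => {.var L.this, .inst x}
  | .instArr a s => {.var L.this, .instArr a} ∪ ⋃ i, (s i).vars

/-- The variable that an assignment to a left-hand side modifies. -/
def Loc.target {T : Sg.Typ} : Loc L T → AnyVar L
  | .var x => .var x
  | .arr a _ => .arr a
  | .inst x => .inst x
  | .instArr a _ => .instArr a

/-- `var(S)`, the variables of a statement. -/
def Stmt.vars : Stmt L → Set (AnyVar L)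
  | .skip => ∅
  | .assign u t => u.vars ∪ t.vars
  | .passign x t => tupVars L x ∪ ⋃ i, (t i).vars
  | .seq S₁ S₂ => S₁.vars ∪ S₂.vars
  | .ite B S₁ S₂ => B.vars ∪ S₁.vars ∪ S₂.vars
  | .fail B S => B.vars ∪ S.vars
  | .while B S => B.vars ∪ S.vars
  | .block x t S => tupVars L x ∪ (⋃ i, (t i).vars) ∪ S.vars
  | .call s _ t => s.vars ∪ ⋃ i, (t i).vars

/-- `change(S)`, the global variables that can be modified by a statement (the effect of
method calls is covered by `change(D)`). -/
def Stmt.change : Stmt L → Set (AnyVar L)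
  | .skip => ∅
  | .assign u _ => {u.target}
  | .passign x _ => tupVars L x
  | .seq S₁ S₂ => S₁.change ∪ S₂.change
  | .ite _ S₁ S₂ => S₁.change ∪ S₂.change
  | .fail _ S => S.change
  | .while _ S => S.change
  | .block x _ S => S.change \ tupVars L x
  | .call _ _ _ => ∅

/-- `var(D)`, the variables of the declarations. The variable `this` counts as an implicit formal
parameter of every method. -/
def Decls.vars (D : Decls L) : Set (AnyVar L) :=
  {v | ∃ (ts : List Sg.Typ) (m : L.Meth ts) (d : Decl L ts), D m = some d ∧
    v ∈ {AnyVar.var L.this} ∪ tupVars L d.formals ∪ d.body.vars}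

/-- `change(D)`, the global variables that can be modified by the bodies of the methods; the formal
parameters are local. -/
def Decls.change (D : Decls L) : Set (AnyVar L) :=
  {v | ∃ (ts : List Sg.Typ) (m : L.Meth ts) (d : Decl L ts), D m = some d ∧
    v ∈ d.body.change \ ({AnyVar.var L.this} ∪ tupVars L d.formals)}

/-! ### Object-oriented programs: substitution -/

/-- The subscripted or instance variable to be replaced by a substitution, if there is one, with
the expression that replaces it. -/
inductive Upd {Sg : Sig} (L : Lang Sg) : Type
  | none : Upd L
  | arr {ts : List Sg.Typ} {T : Sg.Typ} (a : L.Arr ts T) (i : Tup (Expr L Scope.glob) ts)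
      (t : Expr L Scope.glob T) : Upd L
  | inst {T : Sg.Typ} (x : L.IVar T) (t : Expr L Scope.glob T) : Upd L
  | instArr {ts : List Sg.Typ} {T : Sg.Typ} (a : L.IArr ts T) (i : Tup (Expr L Scope.glob) ts)
      (t : Expr L Scope.glob T) : Upd L

/-- A substitution: a simultaneous substitution of global expressions for simple normal variables,
combined with the substitution for at most one subscripted or instance variable. (The combination
is needed where bound variables are renamed.) -/
structure Sub {Sg : Sig} (L : Lang Sg) where
  simple : ∀ ⦃T : Sg.Typ⦄, Sg.Var T → Expr L Scope.glob T
  upd : Upd L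

/-- The value of `a[s₁,…,sₙ]` under the substitution, `s` being the substituted subscripts. -/
def Sub.atArr (θ : Sub L) {ts : List Sg.Typ} {T : Sg.Typ} (a : L.Arr ts T)
    (s : Tup (Expr L Scope.glob) ts) : Expr L Scope.glob T :=
  match θ.upd with
  | .arr (ts := us) (T := U) b i t =>
    if h : (⟨us, U, b⟩ : Σ us : List Sg.Typ, Σ U : Sg.Typ, L.Arr us U) = ⟨ts, T, a⟩ then
      .cond
        (Expr.bigAnd (List.ofFn fun k => .eq (s k)
          (cast (congrArg (fun z : (Σ us : List Sg.Typ, Σ U : Sg.Typ, L.Arr us U) =>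
            Tup (Expr L Scope.glob) z.1) h) i k)))
        (cast (congrArg (fun z : (Σ us : List Sg.Typ, Σ U : Sg.Typ, L.Arr us U) =>
          Expr L Scope.glob z.2.1) h) t)
        (.arr a s)
    else .arr a s
  | _ => .arr a s

/-- The value of `e.x` under the substitution, `e` being already substituted. -/
def Sub.atInst (θ : Sub L) {T : Sg.Typ} (e : Expr L Scope.glob Ty.obj) (x : L.IVar T) :
    Expr L Scope.glob T :=
  match θ.upd with
  | .inst (T := U) y t =>
    if h : (⟨U, y⟩ : Σ U : Sg.Typ, L.IVar U) = ⟨T, x⟩ then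
      .cond (.eq e (.var L.this))
        (cast (congrArg (fun z : (Σ U : Sg.Typ, L.IVar U) => Expr L Scope.glob z.1) h) t)
        (.nav e x)
    else .nav e x
  | _ => .nav e x

/-- The value of `e.a[s₁,…,sₙ]` under the substitution, `e` and `s` being already substituted. -/
def Sub.atInstArr (θ : Sub L) {ts : List Sg.Typ} {T : Sg.Typ} (e : Expr L Scope.glob Ty.obj)
    (a : L.IArr ts T) (s : Tup (Expr L Scope.glob) ts) : Expr L Scope.glob T :=
  match θ.upd with
  | .instArr (ts := us) (T := U) b i t =>
    if h : (⟨us, U, b⟩ : Σ us : List Sg.Typ, Σ U : Sg.Typ, L.IArr us U) = ⟨ts, T, a⟩ then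
      .cond
        (Expr.bigAnd (.eq e (.var L.this) :: List.ofFn fun k => .eq (s k)
          (cast (congrArg (fun z : (Σ us : List Sg.Typ, Σ U : Sg.Typ, L.IArr us U) =>
            Tup (Expr L Scope.glob) z.1) h) i k)))
        (cast (congrArg (fun z : (Σ us : List Sg.Typ, Σ U : Sg.Typ, L.IArr us U) =>
          Expr L Scope.glob z.2.1) h) t)
        (.navArr e a s)
    else .navArr e a s
  | _ => .navArr e a s

/-- Substitution in expressions. An instance variable `u` is treated as `this.u`. -/
def Expr.subst (θ : Sub L) {g : Scope} {T : Sg.Typ} : Expr L g T → Expr L Scope.glob T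
  | .var x => θ.simple x
  | .arr a s => θ.atArr a fun i => (s i).subst θ
  | .inst x => θ.atInst (θ.simple L.this) x
  | .instArr a s => θ.atInstArr (θ.simple L.this) a fun i => (s i).subst θ
  | .null => .null
  | .tt => .tt
  | .not b => .not (b.subst θ)
  | .and b c => .and (b.subst θ) (c.subst θ)
  | .eq s t => .eq (s.subst θ) (t.subst θ)
  | .cond b s t => .cond (b.subst θ) (s.subst θ) (t.subst θ)
  | .fn f s => .fn f fun i => (s i).subst θ
  | .nav e x => θ.atInst (e.subst θ) x
  | .navArr e a s => θ.atInstArr (e.subst θ) a fun i => (s i).subst θ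

/-- The variables that the substitution for a subscripted or instance variable refers to. -/
def Upd.vars : Upd L → Set (AnyVar L)
  | .none => ∅
  | .arr a i t => {.arr a} ∪ (⋃ k, (i k).vars) ∪ t.vars
  | .inst x t => {.var L.this, .inst x} ∪ t.vars
  | .instArr a i t => {.var L.this, .instArr a} ∪ (⋃ k, (i k).vars) ∪ t.vars

/-- A name for the bound variable `x` of a quantified assertion with free variables `V` that is
not captured by the substitution: `x` itself if possible, and a fresh variable otherwise. -/
def Sub.fresh (θ : Sub L) {T : Sg.Typ} (x : Sg.Var T) (V : Set (AnyVar L)) : Sg.Var T :=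
  let avoid : Set (AnyVar L) :=
    θ.upd.vars ∪ {v | ∃ (U : Sg.Typ) (z : Sg.Var U), AnyVar.var z ∈ V ∧ v ∈ (θ.simple z).vars}
  if AnyVar.var x ∉ avoid then x
  else if h : ∃ y : Sg.Var T, AnyVar.var y ∉ avoid then h.choose else x

/-- The substitution `θ`, except that `x` is replaced by the variable `y`. -/
def Sub.rename (θ : Sub L) {T : Sg.Typ} (x y : Sg.Var T) : Sub L :=
  { θ with simple := bindOne (F := Expr L Scope.glob) x (.var y) θ.simple }

/-- Capture-avoiding substitution in assertions. -/
def Assn.subst : Sub L → Assn L → Assn L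
  | θ, .atom b => .atom (b.subst θ)
  | θ, .not p => .not (p.subst θ)
  | θ, .and p q => .and (p.subst θ) (q.subst θ)
  | θ, .or p q => .or (p.subst θ) (q.subst θ)
  | θ, .ex x p => .ex (θ.fresh x (p.free \ {.var x}))
      (p.subst (θ.rename x (θ.fresh x (p.free \ {.var x}))))
  | θ, .all x p => .all (θ.fresh x (p.free \ {.var x}))
      (p.subst (θ.rename x (θ.fresh x (p.free \ {.var x}))))

/-- The substitution `[u := t]` for a simple or subscripted, normal or instance variable `u`. -/
def Sub.one {T : Sg.Typ} : Loc L T → Expr L Scope.prog T → Sub L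
  | .var x, t => ⟨bindOne (F := Expr L Scope.glob) x t.toGlob fun _ y => .var y, .none⟩
  | .arr a i, t => ⟨fun _ y => .var y, .arr a (fun k => (i k).toGlob) t.toGlob⟩
  | .inst x, t => ⟨fun _ y => .var y, .inst x t.toGlob⟩
  | .instArr a i, t => ⟨fun _ y => .var y, .instArr a (fun k => (i k).toGlob) t.toGlob⟩

/-- The simultaneous substitution `[x₁,…,xₙ := t₁,…,tₙ]` for simple normal variables. -/
def Sub.many {ts : List Sg.Typ} (x : Tup Sg.Var ts) (t : Tup (Expr L Scope.glob) ts) : Sub L :=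
  ⟨bindMany (F := Expr L Scope.glob) x t fun _ y => .var y, .none⟩

/-! ### Object-oriented programs: proof systems -/

/-- Derivability of `{p} S {q}` from the set `A` of assumptions: in the system PO for the mode
`pc`, and in SPO for the mode `spc`. -/
inductive Deriv (D : Decls L) (μ : Mode) (A : Set (Formula L)) :
    Assn L → Stmt L → Assn L → Prop
  | hyp {p q : Assn L} {S : Stmt L} : ⟨p, S, q⟩ ∈ A → Deriv D μ A p S q
  | skip (p : Assn L) : Deriv D μ A p .skip p
  | assign (p : Assn L) {T : Sg.Typ} (u : Loc L T) (t : Expr L Scope.prog T) :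
      Deriv D μ A (p.subst (Sub.one u t)) (.assign u t) p
  | passign (p : Assn L) {ts : List Sg.Typ} (x : Tup Sg.Var ts) (t : Tup (Expr L Scope.prog) ts) :
      Deriv D μ A (p.subst (Sub.many x fun i => (t i).toGlob)) (.passign x t) p
  | comp {p r q : Assn L} {S₁ S₂ : Stmt L} :
      Deriv D μ A p S₁ r → Deriv D μ A r S₂ q → Deriv D μ A p (.seq S₁ S₂) q
  | cond {p q : Assn L} {B : Expr L Scope.prog Ty.bool} {S₁ S₂ : Stmt L} :
      Deriv D μ A (.and p (.ofExpr B)) S₁ q → Deriv D μ A (.and p (.not (.ofExpr B))) S₂ q →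
      Deriv D μ A p (.ite B S₁ S₂) q
  | loop {p : Assn L} {B : Expr L Scope.prog Ty.bool} {S : Stmt L} :
      Deriv D μ A (.and p (.ofExpr B)) S p →
      Deriv D μ A p (.while B S) (.and p (.not (.ofExpr B)))
  | consequence {p p₁ q₁ q : Assn L} {S : Stmt L} :
      p.Implies p₁ → Deriv D μ A p₁ S q₁ → q₁.Implies q → Deriv D μ A p S q
  | failure {p q : Assn L} {B : Expr L Scope.prog Ty.bool} {S : Stmt L} : μ = .pc →
      Deriv D μ A (.and p (.ofExpr B)) S q → Deriv D μ A p (.fail B S) q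
  | failureII {p q : Assn L} {B : Expr L Scope.prog Ty.bool} {S : Stmt L} : μ = .spc →
      p.Implies (.ofExpr B) → Deriv D μ A p S q → Deriv D μ A p (.fail B S) q
  | block {p q : Assn L} {ts : List Sg.Typ} {x : Tup Sg.Var ts} {t : Tup (Expr L Scope.prog) ts}
      {S : Stmt L} : Deriv D μ A p (.seq (.passign x t) S) q → tupVars L x ∩ q.free = ∅ →
      Deriv D μ A p (.block x t S) q
  | disjunction {p r q : Assn L} {S : Stmt L} :
      Deriv D μ A p S q → Deriv D μ A r S q → Deriv D μ A (.or p r) S q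
  | conjunction {p₁ p₂ q₁ q₂ : Assn L} {S : Stmt L} :
      Deriv D μ A p₁ S q₁ → Deriv D μ A p₂ S q₂ → Deriv D μ A (.and p₁ p₂) S (.and q₁ q₂)
  | exIntro {p q : Assn L} {S : Stmt L} {T : Sg.Typ} {x : Sg.Var T} :
      Deriv D μ A p S q → AnyVar.var x ∉ D.vars ∪ S.vars ∪ q.free → Deriv D μ A (.ex x p) S q
  | invariance {p r q : Assn L} {S : Stmt L} :
      Deriv D μ A r S q → p.free ∩ (D.change ∪ S.change) = ∅ →
      Deriv D μ A (.and p r) S (.and p q)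
  | substitution {p q : Assn L} {S : Stmt L} {ts : List Sg.Typ} {z : Tup Sg.Var ts}
      {t : Tup (Expr L Scope.glob) ts} :
      Deriv D μ A p S q → Distinct z → tupVars L z ∩ (D.vars ∪ S.vars) = ∅ →
      (⋃ i, (t i).vars) ∩ (D.change ∪ S.change) = ∅ →
      Deriv D μ A (p.subst (Sub.many z t)) S (q.subst (Sub.many z t))
  | weakening {p q : Assn L} {ts : List Sg.Typ} {s : Expr L Scope.prog Ty.obj} {m : L.Meth ts}
      {t : Tup (Expr L Scope.prog) ts} : μ = .pc →
      Deriv D μ A (.and p (.ofExpr s.neNull)) (.call s m t) q → Deriv D μ A p (.call s m t) q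

/-- A correctness formula `{pre} s.m(t) {post}` about a method call. -/
structure CallSpec {Sg : Sig} (L : Lang Sg) where
  pre : Assn L
  ts : List Sg.Typ
  s : Expr L Scope.prog Ty.obj
  m : L.Meth ts
  t : Tup (Expr L Scope.prog) ts
  post : Assn L

def CallSpec.formula (c : CallSpec L) : Formula L := ⟨c.pre, .call c.s c.m c.t, c.post⟩

/-- The set of assumptions given by a list of formulas about method calls. -/
def CallSpec.asms (A : List (CallSpec L)) : Set (Formula L) := {f | ∃ c ∈ A, c.formula = f}

/-- `f` is the conclusion of an application of the recursion rule (recursion I for the mode `pc`,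
recursion II for the mode `spc`), all of whose premises hold. -/
def RecursionRule (D : Decls L) (μ : Mode) (f : Formula L) : Prop :=
  ∃ A : List (CallSpec L),
    Deriv D μ (CallSpec.asms A) f.pre f.stmt f.post ∧
    (∀ c ∈ A, ∃ d : Decl L c.ts, D c.m = some d ∧
      Deriv D μ (CallSpec.asms A) c.pre (d.inline c.s c.t) c.post) ∧
    (μ = .spc → ∀ c ∈ A, c.pre.Implies (.ofExpr c.s.neNull))

/-- Derivability in the system PO⁺ (mode `pc`) or SPO⁺ (mode `spc`), which adds the recursion rule
to PO or SPO. The recursion rule is not used in the premises of the recursion rule. -/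
def DerivPlus (D : Decls L) (μ : Mode) (p : Assn L) (S : Stmt L) (q : Assn L) : Prop :=
  Deriv D μ {f | RecursionRule D μ f} p S q

/-- Soundness of PO⁺ or SPO⁺ for the programs in `C`. -/
def SoundFor (D : Decls L) (μ : Mode) (C : Set (Stmt L)) : Prop :=
  ∀ S ∈ C, ∀ p q : Assn L, DerivPlus D μ p S q → Valid D μ p S q

/-- Relative completeness of PO⁺ or SPO⁺ for the programs in `C`. -/
def CompleteFor (D : Decls L) (μ : Mode) (C : Set (Stmt L)) : Prop :=
  ∀ S ∈ C, ∀ p q : Assn L, Valid D μ p S q → DerivPlus D μ p S q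

end OO

/-! ### Recursive programs: syntax -/

/-- The vocabulary of recursive programs: array variables and procedure identifiers. -/
structure RLang (Sg : Sig) where
  Arr : List Sg.Typ → Sg.Typ → Type
  arr_nil : ∀ T, IsEmpty (Arr [] T)
  Proc : List Sg.Typ → Type

inductive RExpr {Sg : Sig} (R : RLang Sg) : Sg.Typ → Type
  | var {T : Sg.Typ} (x : Sg.Var T) : RExpr R T
  | arr {ts : List Sg.Typ} {T : Sg.Typ} (a : R.Arr ts T)
      (s : (i : Fin ts.length) → RExpr R (ts.get i)) : RExpr R T
  | null : RExpr R Ty.obj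
  | tt : RExpr R Ty.bool
  | not (b : RExpr R Ty.bool) : RExpr R Ty.bool
  | and (b c : RExpr R Ty.bool) : RExpr R Ty.bool
  | eq {T : Sg.Typ} (s t : RExpr R T) : RExpr R Ty.bool
  | cond {T : Sg.Typ} (b : RExpr R Ty.bool) (s t : RExpr R T) : RExpr R T
  | fn {ts : List Sg.Typ} {T : Sg.Typ} (f : Sg.Fn ts T)
      (s : (i : Fin ts.length) → RExpr R (ts.get i)) : RExpr R T

inductive RAssn {Sg : Sig} (R : RLang Sg) : Type
  | atom (b : RExpr R Ty.bool) : RAssn R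
  | not (p : RAssn R) : RAssn R
  | and (p q : RAssn R) : RAssn R
  | or (p q : RAssn R) : RAssn R
  | ex {T : Sg.Typ} (x : Sg.Var T) (p : RAssn R) : RAssn R
  | all {T : Sg.Typ} (x : Sg.Var T) (p : RAssn R) : RAssn R

inductive RLoc {Sg : Sig} (R : RLang Sg) : Sg.Typ → Type
  | var {T : Sg.Typ} (x : Sg.Var T) : RLoc R T
  | arr {ts : List Sg.Typ} {T : Sg.Typ} (a : R.Arr ts T) (s : Tup (RExpr R) ts) : RLoc R T

/-- Statements of recursive programs; `call P t` is the procedure call `P(t)`. -/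
inductive RStmt {Sg : Sig} (R : RLang Sg) : Type
  | skip : RStmt R
  | assign {T : Sg.Typ} (u : RLoc R T) (t : RExpr R T) : RStmt R
  | passign {ts : List Sg.Typ} (x : Tup Sg.Var ts) (t : Tup (RExpr R) ts) : RStmt R
  | seq (S₁ S₂ : RStmt R) : RStmt R
  | ite (B : RExpr R Ty.bool) (S₁ S₂ : RStmt R) : RStmt R
  | fail (B : RExpr R Ty.bool) (S : RStmt R) : RStmt R
  | while (B : RExpr R Ty.bool) (S : RStmt R) : RStmt R
  | block {ts : List Sg.Typ} (x : Tup Sg.Var ts) (t : Tup (RExpr R) ts) (S : RStmt R) : RStmt R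
  | call {ts : List Sg.Typ} (P : R.Proc ts) (t : Tup (RExpr R) ts) : RStmt R

/-- A procedure declaration `P(u₁,…,uₙ) :: S`, without the name of the procedure. -/
structure RDecl {Sg : Sig} (R : RLang Sg) (ts : List Sg.Typ) where
  formals : Tup Sg.Var ts
  body : RStmt R

abbrev RDecls {Sg : Sig} (R : RLang Sg) : Type :=
  ∀ ⦃ts : List Sg.Typ⦄, R.Proc ts → Option (RDecl R ts)

structure RFormula {Sg : Sig} (R : RLang Sg) where
  pre : RAssn R
  stmt : RStmt R
  post : RAssn R

section Recursive

variable {Sg : Sig} {R : RLang Sg}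

def RExpr.bigAnd : List (RExpr R Ty.bool) → RExpr R Ty.bool
  | [] => .tt
  | [b] => b
  | b :: c :: bs => .and b (RExpr.bigAnd (c :: bs))

/-- The block statement `begin local u := t; S end` that a call `P(t)` amounts to, where
`P(u) :: S` is the declaration of `P`. -/
def RDecl.inline {ts : List Sg.Typ} (d : RDecl R ts) (t : Tup (RExpr R) ts) : RStmt R :=
  .block d.formals t d.body

/-! ### Recursive programs: semantics -/

structure RState {Sg : Sig} (R : RLang Sg) where
  var : ∀ ⦃T : Sg.Typ⦄, Sg.Var T → Sg.Dom T
  arr : ∀ ⦃ts : List Sg.Typ⦄ ⦃T : Sg.Typ⦄, R.Arr ts T → Tup Sg.Dom ts → Sg.Dom T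

def RExpr.eval (σ : RState R) {T : Sg.Typ} : RExpr R T → Sg.Dom T
  | .var x => σ.var x
  | .arr a s => σ.arr a fun i => (s i).eval σ
  | .null => Sg.null
  | .tt => true
  | .not b => Bool.not (b.eval σ)
  | .and b c => Bool.and (b.eval σ) (c.eval σ)
  | .eq s t => decide (s.eval σ = t.eval σ)
  | .cond b s t => if b.eval σ = true then s.eval σ else t.eval σ
  | .fn f s => Sg.fn f fun i => (s i).eval σ

def RExpr.IsTrue (B : RExpr R Ty.bool) (σ : RState R) : Prop := B.eval σ = true

def RState.setVar (σ : RState R) {T : Sg.Typ} (x : Sg.Var T) (d : Sg.Dom T) : RState R :=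
  { σ with var := bindOne (F := Sg.Dom) x d σ.var }

def RState.setVars (σ : RState R) {ts : List Sg.Typ} (x : Tup Sg.Var ts) (d : Tup Sg.Dom ts) :
    RState R :=
  { σ with var := bindMany (F := Sg.Dom) x d σ.var }

def RState.set (σ : RState R) {T : Sg.Typ} : RLoc R T → Sg.Dom T → RState R
  | .var x, d => σ.setVar x d
  | .arr a s, d => { σ with arr := updArr (A := R.Arr) σ.arr a (fun i => (s i).eval σ) d }

/-- `RExec D S σ r`: started in the proper state `σ`, the statement `S` has a terminating
computation with final state `r`, where `none` is the state `fail`. -/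
inductive RExec (D : RDecls R) : RStmt R → RState R → Option (RState R) → Prop
  | skip (σ : RState R) : RExec D .skip σ (some σ)
  | assign (σ : RState R) {T : Sg.Typ} (u : RLoc R T) (t : RExpr R T) :
      RExec D (.assign u t) σ (some (σ.set u (t.eval σ)))
  | passign (σ : RState R) {ts : List Sg.Typ} (x : Tup Sg.Var ts) (t : Tup (RExpr R) ts) :
      RExec D (.passign x t) σ (some (σ.setVars x fun i => (t i).eval σ))
  | seq {S₁ S₂ : RStmt R} {σ τ : RState R} {r : Option (RState R)} :
      RExec D S₁ σ (some τ) → RExec D S₂ τ r → RExec D (.seq S₁ S₂) σ r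
  | seq_fail {S₁ S₂ : RStmt R} {σ : RState R} :
      RExec D S₁ σ none → RExec D (.seq S₁ S₂) σ none
  | ite_true {B : RExpr R Ty.bool} {S₁ S₂ : RStmt R} {σ : RState R} {r : Option (RState R)} :
      B.IsTrue σ → RExec D S₁ σ r → RExec D (.ite B S₁ S₂) σ r
  | ite_false {B : RExpr R Ty.bool} {S₁ S₂ : RStmt R} {σ : RState R} {r : Option (RState R)} :
      ¬ B.IsTrue σ → RExec D S₂ σ r → RExec D (.ite B S₁ S₂) σ r
  | fail_true {B : RExpr R Ty.bool} {S : RStmt R} {σ : RState R} {r : Option (RState R)} :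
      B.IsTrue σ → RExec D S σ r → RExec D (.fail B S) σ r
  | fail_false {B : RExpr R Ty.bool} {S : RStmt R} {σ : RState R} :
      ¬ B.IsTrue σ → RExec D (.fail B S) σ none
  | while_true {B : RExpr R Ty.bool} {S : RStmt R} {σ : RState R} {r : Option (RState R)} :
      B.IsTrue σ → RExec D (.seq S (.while B S)) σ r → RExec D (.while B S) σ r
  | while_false {B : RExpr R Ty.bool} {S : RStmt R} {σ : RState R} :
      ¬ B.IsTrue σ → RExec D (.while B S) σ (some σ)
  | block {ts : List Sg.Typ} {x : Tup Sg.Var ts} {t : Tup (RExpr R) ts} {S : RStmt R}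
      {σ τ : RState R} : RExec D (.seq (.passign x t) S) σ (some τ) →
      RExec D (.block x t S) σ (some (τ.setVars x fun i => σ.var (x i)))
  | block_fail {ts : List Sg.Typ} {x : Tup Sg.Var ts} {t : Tup (RExpr R) ts} {S : RStmt R}
      {σ : RState R} : RExec D (.seq (.passign x t) S) σ none → RExec D (.block x t S) σ none
  | call {ts : List Sg.Typ} {P : R.Proc ts} {t : Tup (RExpr R) ts} {d : RDecl R ts}
      {σ : RState R} {r : Option (RState R)} :
      D P = some d → RExec D (d.inline t) σ r → RExec D (.call P t) σ r

def RAssn.Sat : RState R → RAssn R → Prop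
  | σ, .atom b => b.IsTrue σ
  | σ, .not p => ¬ p.Sat σ
  | σ, .and p q => p.Sat σ ∧ q.Sat σ
  | σ, .or p q => p.Sat σ ∨ q.Sat σ
  | σ, .ex (T := T) x p => ∃ d : Sg.Dom T, p.Sat (σ.setVar x d)
  | σ, .all (T := T) x p => ∀ d : Sg.Dom T, p.Sat (σ.setVar x d)

def RAssn.Implies (p q : RAssn R) : Prop := ∀ σ : RState R, p.Sat σ → q.Sat σ

def RValid (D : RDecls R) : Mode → RAssn R → RStmt R → RAssn R → Prop
  | .pc, p, S, q => ∀ σ τ : RState R, p.Sat σ → RExec D S σ (some τ) → q.Sat τ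
  | .spc, p, S, q => ∀ (σ : RState R) (r : Option (RState R)), p.Sat σ → RExec D S σ r →
      ∃ τ, r = some τ ∧ q.Sat τ

/-! ### Recursive programs: variables -/

inductive RAnyVar {Sg : Sig} (R : RLang Sg) : Type
  | var {T : Sg.Typ} (x : Sg.Var T) : RAnyVar R
  | arr {ts : List Sg.Typ} {T : Sg.Typ} (a : R.Arr ts T) : RAnyVar R

def rtupVars (R : RLang Sg) {ts : List Sg.Typ} (x : Tup Sg.Var ts) : Set (RAnyVar R) :=
  Set.range fun i => RAnyVar.var (x i)

def RExpr.vars {T : Sg.Typ} : RExpr R T → Set (RAnyVar R)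
  | .var x => {.var x}
  | .arr a s => {.arr a} ∪ ⋃ i, (s i).vars
  | .null => ∅
  | .tt => ∅
  | .not b => b.vars
  | .and b c => b.vars ∪ c.vars
  | .eq s t => s.vars ∪ t.vars
  | .cond b s t => b.vars ∪ s.vars ∪ t.vars
  | .fn _ s => ⋃ i, (s i).vars

def RAssn.free : RAssn R → Set (RAnyVar R)
  | .atom b => b.vars
  | .not p => p.free
  | .and p q => p.free ∪ q.free
  | .or p q => p.free ∪ q.free
  | .ex x p => p.free \ {.var x}
  | .all x p => p.free \ {.var x}

def RLoc.vars {T : Sg.Typ} : RLoc R T → Set (RAnyVar R)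
  | .var x => {.var x}
  | .arr a s => {.arr a} ∪ ⋃ i, (s i).vars

def RLoc.target {T : Sg.Typ} : RLoc R T → RAnyVar R
  | .var x => .var x
  | .arr a _ => .arr a

def RStmt.vars : RStmt R → Set (RAnyVar R)
  | .skip => ∅
  | .assign u t => u.vars ∪ t.vars
  | .passign x t => rtupVars R x ∪ ⋃ i, (t i).vars
  | .seq S₁ S₂ => S₁.vars ∪ S₂.vars
  | .ite B S₁ S₂ => B.vars ∪ S₁.vars ∪ S₂.vars
  | .fail B S => B.vars ∪ S.vars
  | .while B S => B.vars ∪ S.vars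
  | .block x t S => rtupVars R x ∪ (⋃ i, (t i).vars) ∪ S.vars
  | .call _ t => ⋃ i, (t i).vars

def RStmt.change : RStmt R → Set (RAnyVar R)
  | .skip => ∅
  | .assign u _ => {u.target}
  | .passign x _ => rtupVars R x
  | .seq S₁ S₂ => S₁.change ∪ S₂.change
  | .ite _ S₁ S₂ => S₁.change ∪ S₂.change
  | .fail _ S => S.change
  | .while _ S => S.change
  | .block x _ S => S.change \ rtupVars R x
  | .call _ _ => ∅

def RDecls.vars (D : RDecls R) : Set (RAnyVar R) :=
  {v | ∃ (ts : List Sg.Typ) (P : R.Proc ts) (d : RDecl R ts), D P = some d ∧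
    v ∈ rtupVars R d.formals ∪ d.body.vars}

def RDecls.change (D : RDecls R) : Set (RAnyVar R) :=
  {v | ∃ (ts : List Sg.Typ) (P : R.Proc ts) (d : RDecl R ts), D P = some d ∧
    v ∈ d.body.change \ rtupVars R d.formals}

/-! ### Recursive programs: substitution -/

inductive RUpd {Sg : Sig} (R : RLang Sg) : Type
  | none : RUpd R
  | arr {ts : List Sg.Typ} {T : Sg.Typ} (a : R.Arr ts T) (i : Tup (RExpr R) ts)
      (t : RExpr R T) : RUpd R

/-- A simultaneous substitution for simple variables, combined with the substitution for at most
one subscripted variable. -/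
structure RSub {Sg : Sig} (R : RLang Sg) where
  simple : ∀ ⦃T : Sg.Typ⦄, Sg.Var T → RExpr R T
  upd : RUpd R

def RSub.atArr (θ : RSub R) {ts : List Sg.Typ} {T : Sg.Typ} (a : R.Arr ts T)
    (s : Tup (RExpr R) ts) : RExpr R T :=
  match θ.upd with
  | .arr (ts := us) (T := U) b i t =>
    if h : (⟨us, U, b⟩ : Σ us : List Sg.Typ, Σ U : Sg.Typ, R.Arr us U) = ⟨ts, T, a⟩ then
      .cond
        (RExpr.bigAnd (List.ofFn fun k => .eq (s k)
          (cast (congrArg (fun z : (Σ us : List Sg.Typ, Σ U : Sg.Typ, R.Arr us U) =>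
            Tup (RExpr R) z.1) h) i k)))
        (cast (congrArg (fun z : (Σ us : List Sg.Typ, Σ U : Sg.Typ, R.Arr us U) =>
          RExpr R z.2.1) h) t)
        (.arr a s)
    else .arr a s
  | _ => .arr a s

def RExpr.subst (θ : RSub R) {T : Sg.Typ} : RExpr R T → RExpr R T
  | .var x => θ.simple x
  | .arr a s => θ.atArr a fun i => (s i).subst θ
  | .null => .null
  | .tt => .tt
  | .not b => .not (b.subst θ)
  | .and b c => .and (b.subst θ) (c.subst θ)
  | .eq s t => .eq (s.subst θ) (t.subst θ)
  | .cond b s t => .cond (b.subst θ) (s.subst θ) (t.subst θ)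
  | .fn f s => .fn f fun i => (s i).subst θ

def RUpd.vars : RUpd R → Set (RAnyVar R)
  | .none => ∅
  | .arr a i t => {.arr a} ∪ (⋃ k, (i k).vars) ∪ t.vars

def RSub.fresh (θ : RSub R) {T : Sg.Typ} (x : Sg.Var T) (V : Set (RAnyVar R)) : Sg.Var T :=
  let avoid : Set (RAnyVar R) :=
    θ.upd.vars ∪ {v | ∃ (U : Sg.Typ) (z : Sg.Var U), RAnyVar.var z ∈ V ∧ v ∈ (θ.simple z).vars}
  if RAnyVar.var x ∉ avoid then x
  else if h : ∃ y : Sg.Var T, RAnyVar.var y ∉ avoid then h.choose else x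

def RSub.rename (θ : RSub R) {T : Sg.Typ} (x y : Sg.Var T) : RSub R :=
  { θ with simple := bindOne (F := RExpr R) x (.var y) θ.simple }

/-- Capture-avoiding substitution in assertions. -/
def RAssn.subst : RSub R → RAssn R → RAssn R
  | θ, .atom b => .atom (b.subst θ)
  | θ, .not p => .not (p.subst θ)
  | θ, .and p q => .and (p.subst θ) (q.subst θ)
  | θ, .or p q => .or (p.subst θ) (q.subst θ)
  | θ, .ex x p => .ex (θ.fresh x (p.free \ {.var x}))
      (p.subst (θ.rename x (θ.fresh x (p.free \ {.var x}))))
  | θ, .all x p => .all (θ.fresh x (p.free \ {.var x}))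
      (p.subst (θ.rename x (θ.fresh x (p.free \ {.var x}))))

def RSub.one {T : Sg.Typ} : RLoc R T → RExpr R T → RSub R
  | .var x, t => ⟨bindOne (F := RExpr R) x t fun _ y => .var y, .none⟩
  | .arr a i, t => ⟨fun _ y => .var y, .arr a i t⟩

def RSub.many {ts : List Sg.Typ} (x : Tup Sg.Var ts) (t : Tup (RExpr R) ts) : RSub R :=
  ⟨bindMany (F := RExpr R) x t fun _ y => .var y, .none⟩

/-! ### Recursive programs: proof systems -/

/-- Derivability of `{p} S {q}` from the set `A` of assumptions: in the system PR for the mode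
`pc`, and in SPR for the mode `spc`. -/
inductive RDeriv (D : RDecls R) (μ : Mode) (A : Set (RFormula R)) :
    RAssn R → RStmt R → RAssn R → Prop
  | hyp {p q : RAssn R} {S : RStmt R} : ⟨p, S, q⟩ ∈ A → RDeriv D μ A p S q
  | skip (p : RAssn R) : RDeriv D μ A p .skip p
  | assign (p : RAssn R) {T : Sg.Typ} (u : RLoc R T) (t : RExpr R T) :
      RDeriv D μ A (p.subst (RSub.one u t)) (.assign u t) p
  | passign (p : RAssn R) {ts : List Sg.Typ} (x : Tup Sg.Var ts) (t : Tup (RExpr R) ts) :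
      RDeriv D μ A (p.subst (RSub.many x t)) (.passign x t) p
  | comp {p r q : RAssn R} {S₁ S₂ : RStmt R} :
      RDeriv D μ A p S₁ r → RDeriv D μ A r S₂ q → RDeriv D μ A p (.seq S₁ S₂) q
  | cond {p q : RAssn R} {B : RExpr R Ty.bool} {S₁ S₂ : RStmt R} :
      RDeriv D μ A (.and p (.atom B)) S₁ q → RDeriv D μ A (.and p (.not (.atom B))) S₂ q →
      RDeriv D μ A p (.ite B S₁ S₂) q
  | loop {p : RAssn R} {B : RExpr R Ty.bool} {S : RStmt R} :
      RDeriv D μ A (.and p (.atom B)) S p →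
      RDeriv D μ A p (.while B S) (.and p (.not (.atom B)))
  | consequence {p p₁ q₁ q : RAssn R} {S : RStmt R} :
      p.Implies p₁ → RDeriv D μ A p₁ S q₁ → q₁.Implies q → RDeriv D μ A p S q
  | failure {p q : RAssn R} {B : RExpr R Ty.bool} {S : RStmt R} : μ = .pc →
      RDeriv D μ A (.and p (.atom B)) S q → RDeriv D μ A p (.fail B S) q
  | failureII {p q : RAssn R} {B : RExpr R Ty.bool} {S : RStmt R} : μ = .spc →
      p.Implies (.atom B) → RDeriv D μ A p S q → RDeriv D μ A p (.fail B S) q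
  | block {p q : RAssn R} {ts : List Sg.Typ} {x : Tup Sg.Var ts} {t : Tup (RExpr R) ts}
      {S : RStmt R} : RDeriv D μ A p (.seq (.passign x t) S) q → rtupVars R x ∩ q.free = ∅ →
      RDeriv D μ A p (.block x t S) q
  | disjunction {p r q : RAssn R} {S : RStmt R} :
      RDeriv D μ A p S q → RDeriv D μ A r S q → RDeriv D μ A (.or p r) S q
  | conjunction {p₁ p₂ q₁ q₂ : RAssn R} {S : RStmt R} :
      RDeriv D μ A p₁ S q₁ → RDeriv D μ A p₂ S q₂ → RDeriv D μ A (.and p₁ p₂) S (.and q₁ q₂)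
  | exIntro {p q : RAssn R} {S : RStmt R} {T : Sg.Typ} {x : Sg.Var T} :
      RDeriv D μ A p S q → RAnyVar.var x ∉ D.vars ∪ S.vars ∪ q.free → RDeriv D μ A (.ex x p) S q
  | invariance {p r q : RAssn R} {S : RStmt R} :
      RDeriv D μ A r S q → p.free ∩ (D.change ∪ S.change) = ∅ →
      RDeriv D μ A (.and p r) S (.and p q)
  | substitution {p q : RAssn R} {S : RStmt R} {ts : List Sg.Typ} {z : Tup Sg.Var ts}
      {t : Tup (RExpr R) ts} :
      RDeriv D μ A p S q → Distinct z → rtupVars R z ∩ (D.vars ∪ S.vars) = ∅ →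
      (⋃ i, (t i).vars) ∩ (D.change ∪ S.change) = ∅ →
      RDeriv D μ A (p.subst (RSub.many z t)) S (q.subst (RSub.many z t))

/-- A correctness formula `{pre} P(t) {post}` about a procedure call. -/
structure RCallSpec {Sg : Sig} (R : RLang Sg) where
  pre : RAssn R
  ts : List Sg.Typ
  P : R.Proc ts
  t : Tup (RExpr R) ts
  post : RAssn R

def RCallSpec.formula (c : RCallSpec R) : RFormula R := ⟨c.pre, .call c.P c.t, c.post⟩

def RCallSpec.asms (A : List (RCallSpec R)) : Set (RFormula R) := {f | ∃ c ∈ A, c.formula = f}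

/-- `f` is the conclusion of an application of the rule recursion III, all of whose premises
hold. -/
def RRecursionRule (D : RDecls R) (μ : Mode) (f : RFormula R) : Prop :=
  ∃ A : List (RCallSpec R),
    RDeriv D μ (RCallSpec.asms A) f.pre f.stmt f.post ∧
    ∀ c ∈ A, ∃ d : RDecl R c.ts, D c.P = some d ∧
      RDeriv D μ (RCallSpec.asms A) c.pre (d.inline c.t) c.post

/-- Derivability in the system PR⁺ (mode `pc`) or SPR⁺ (mode `spc`), which adds the recursion rule
to PR or SPR. -/
def RDerivPlus (D : RDecls R) (μ : Mode) (p : RAssn R) (S : RStmt R) (q : RAssn R) : Prop :=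
  RDeriv D μ {f | RRecursionRule D μ f} p S q

/-- Soundness of PR⁺ or SPR⁺ for the programs in `C`. -/
def RSoundFor (D : RDecls R) (μ : Mode) (C : Set (RStmt R)) : Prop :=
  ∀ S ∈ C, ∀ p q : RAssn R, RDerivPlus D μ p S q → RValid D μ p S q

/-- Relative completeness of PR⁺ or SPR⁺ for the programs in `C`. -/
def RCompleteFor (D : RDecls R) (μ : Mode) (C : Set (RStmt R)) : Prop :=
  ∀ S ∈ C, ∀ p q : RAssn R, RValid D μ p S q → RDerivPlus D μ p S q

end Recursive

/-! ### The translation -/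

/-- The array variables of the recursive programs: the normal ones, an array variable of type
`object → T` for each instance variable of type `T`, and an array variable of type
`object × T₁ × … × Tₙ → T` for each instance array variable of type `T₁ × … × Tₙ → T`. -/
inductive TransArr {Sg : Sig} (L : Lang Sg) : List Sg.Typ → Sg.Typ → Type
  | normal {ts : List Sg.Typ} {T : Sg.Typ} (a : L.Arr ts T) : TransArr L ts T
  | inst {T : Sg.Typ} (x : L.IVar T) : TransArr L [Ty.obj] T
  | instArr {ts : List Sg.Typ} {T : Sg.Typ} (a : L.IArr ts T) : TransArr L (Ty.obj :: ts) T

/-- The procedures of the recursive programs: the methods, with an additional first parameter. -/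
inductive TransProc {Sg : Sig} (L : Lang Sg) : List Sg.Typ → Type
  | meth {ts : List Sg.Typ} (m : L.Meth ts) : TransProc L (Ty.obj :: ts)

section Translation

variable {Sg : Sig}

/-- The vocabulary of the recursive programs into which the programs over `L` are translated. -/
abbrev Lang.trans (L : Lang Sg) : RLang Sg where
  Arr := TransArr L
  arr_nil := fun T => ⟨fun a => by
    cases a with
    | normal a => exact (L.arr_nil T).false a⟩
  Proc := TransProc L

variable {L : Lang Sg}

/-- The translation `Θ` of expressions and global expressions. -/
def Expr.trans {g : Scope} {T : Sg.Typ} : Expr L g T → RExpr L.trans T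
  | .var x => .var x
  | .arr a s => .arr (R := L.trans) (TransArr.normal a) fun i => (s i).trans
  | .inst x => .arr (R := L.trans) (TransArr.inst x)
      (Tup.cons (F := RExpr L.trans) (.var L.this) Tup.nil)
  | .instArr a s => .arr (R := L.trans) (TransArr.instArr a)
      (Tup.cons (F := RExpr L.trans) (.var L.this) fun i => (s i).trans)
  | .null => .null
  | .tt => .tt
  | .not b => .not b.trans
  | .and b c => .and b.trans c.trans
  | .eq s t => .eq s.trans t.trans
  | .cond b s t => .cond b.trans s.trans t.trans
  | .fn f s => .fn f fun i => (s i).trans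
  | .nav e x => .arr (R := L.trans) (TransArr.inst x)
      (Tup.cons (F := RExpr L.trans) e.trans Tup.nil)
  | .navArr e a s => .arr (R := L.trans) (TransArr.instArr a)
      (Tup.cons (F := RExpr L.trans) e.trans fun i => (s i).trans)

/-- The translation of assertions. -/
def Assn.trans : Assn L → RAssn L.trans
  | .atom b => .atom b.trans
  | .not p => .not p.trans
  | .and p q => .and p.trans q.trans
  | .or p q => .or p.trans q.trans
  | .ex x p => .ex x p.trans
  | .all x p => .all x p.trans

/-- The translation of simple and subscripted variables. -/
def Loc.trans {T : Sg.Typ} : Loc L T → RLoc L.trans T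
  | .var x => .var x
  | .arr a s => .arr (R := L.trans) (TransArr.normal a) fun i => (s i).trans
  | .inst x => .arr (R := L.trans) (TransArr.inst x)
      (Tup.cons (F := RExpr L.trans) (.var L.this) Tup.nil)
  | .instArr a s => .arr (R := L.trans) (TransArr.instArr a)
      (Tup.cons (F := RExpr L.trans) (.var L.this) fun i => (s i).trans)

/-- The translation of statements; `s.m(t)` becomes `if Θ(s) ≠ null → m(Θ(s),Θ(t)) fi`. -/
def Stmt.trans : Stmt L → RStmt L.trans
  | .skip => .skip
  | .assign u t => .assign u.trans t.trans
  | .passign x t => .passign x fun i => (t i).trans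
  | .seq S₁ S₂ => .seq S₁.trans S₂.trans
  | .ite B S₁ S₂ => .ite B.trans S₁.trans S₂.trans
  | .fail B S => .fail B.trans S.trans
  | .while B S => .while B.trans S.trans
  | .block x t S => .block x (fun i => (t i).trans) S.trans
  | .call s m t => .fail (.not (.eq s.trans .null))
      (.call (R := L.trans) (TransProc.meth m)
        (Tup.cons (F := RExpr L.trans) s.trans fun i => (t i).trans))

/-- The translation of a method declaration: `this` becomes the first formal parameter. -/
def Decl.trans {ts : List Sg.Typ} (d : Decl L ts) : RDecl L.trans (Ty.obj :: ts) :=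
  ⟨Tup.cons (F := Sg.Var) L.this d.formals, d.body.trans⟩

/-- The translation of a set of method declarations. -/
def Decls.trans (D : Decls L) : RDecls L.trans := fun _ P =>
  match P with
  | .meth m => (D m).map Decl.trans

end Translation

end OOVerif

end

/-!
The translation `Θ` does not lose information: a global expression can be recovered from its
translation up to replacing an instance variable `x` by `this.x`, every expression and every
assertion of the recursive language is a translation (`RExpr.trans_toGlob`, `RAssn.trans_toAssn`),
and states of the two languages correspond bijectively (`State.trans`, `RState.toState`) in such a
way that values, truth of assertions, and hence implications between assertions are preserved
(`Assn.implies_trans`). Moreover `Θ` commutes with substitution on the nose (`Assn.subst_trans`),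
including the choice of bound variables, and it maps `var`, `change` and `free` bijectively.
Therefore each rule of one proof system, applied to translated formulas, is a rule of the other one,
up to consequence.

The only exception is the method call: `s.m(t)` becomes the failure statement
`if Θ(s) ≠ null → m(Θ(s), Θ(t)) fi`, whose body is not itself a translation. The relation `TransRel`
accounts for it by pairing `s.m(t)` also with the bare call `m(Θ(s), Θ(t))`, under the guard
`s ≠ null`. Both simulation lemmas, `Deriv.trans` and `RDeriv.toDeriv`, say that `{p} S {q}` on the
object-oriented side amounts to `{p ∧ G} S' {q}` on the recursive side, and conversely, for every
related pair `S`, `S'` with guard `G`. For partial correctness, the failure rule applied to the bare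
call matches the weakening rule for `s.m(t)`; for strong partial correctness, the premise that the
precondition implies `s ≠ null` matches the side condition of the recursion rule.

Accordingly an assumption `{p} s.m(t) {q}` of the recursion rule is turned into
`{p ∧ s ≠ null} m(Θ(s), Θ(t)) {q}`, and an assumption about a call `m(Θ(s), Θ(t))` is turned into one
about `s.m(t)` with the precondition strengthened by `s ≠ null`. Assumptions about procedure calls
whose arguments are not translations of program expressions are dropped: no such call occurs in a
translated program or declaration.

For soundness and completeness it remains to match computations (`Exec.trans`,
`RExec.exists_exec`), which yields `Stmt.IsProgram.valid_iff`.
-/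

noncomputable section
open scoped Classical

namespace OOVerif

/-! ### Sequences -/

section Sequences

variable {B : Type} {F G : Ty B → Type} {T : Ty B} {ts : List (Ty B)}

theorem Tup.map_cons (f : ∀ ⦃U⦄, F U → G U) (x : F T) (s : Tup F ts) :
    (fun i => f (Tup.cons x s i) : Tup G (T :: ts)) = Tup.cons (f x) fun i => f (s i) := by
  funext i
  exact Fin.cases rfl (fun _ => rfl) i

theorem Tup.cons_head_tail (v : Tup F (T :: ts)) :
    Tup.cons (F := F) (v 0) (fun i => v i.succ) = v := by
  funext i
  exact Fin.cases rfl (fun _ => rfl) i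

theorem Tup.cons_head_nil (v : Tup F [T]) : Tup.cons (F := F) (v 0) Tup.nil = v := by
  funext i
  exact Fin.cases rfl (fun j => j.elim0) i

theorem Tup.iUnion_cons {α : Type} (f : ∀ ⦃U⦄, F U → Set α) (x : F T) (s : Tup F ts) :
    ⋃ i, f (Tup.cons x s i) = f x ∪ ⋃ i, f (s i) := by
  ext v
  simp only [Set.mem_iUnion, Set.mem_union]
  constructor
  · rintro ⟨i, hi⟩
    revert hi
    exact Fin.cases (fun h => Or.inl h) (fun j h => Or.inr ⟨j, h⟩) i
  · rintro (h | ⟨i, h⟩)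
    · exact ⟨(0 : Fin (ts.length + 1)), h⟩
    · exact ⟨i.succ, h⟩

theorem Tup.iUnion_nil {α : Type} (f : ∀ ⦃U⦄, F U → Set α) :
    ⋃ i, f ((Tup.nil : Tup F []) i) = ∅ :=
  Set.iUnion_eq_empty.2 fun i => i.elim0

end Sequences

section Translations

variable {Sg : Sig} {L : Lang Sg}

theorem rtupVars_cons {R : RLang Sg} {T : Sg.Typ} {ts : List Sg.Typ} (x : Sg.Var T)
    (s : Tup Sg.Var ts) :
    rtupVars R (Tup.cons (F := Sg.Var) x s) = {RAnyVar.var x} ∪ rtupVars R s := by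
  have h := Tup.iUnion_cons (F := Sg.Var) (fun _ y => ({RAnyVar.var y} : Set (RAnyVar R))) x s
  rwa [Set.iUnion_singleton_eq_range, Set.iUnion_singleton_eq_range] at h

theorem RExpr.iUnion_vars_cons {R : RLang Sg} {T : Sg.Typ} {ts : List Sg.Typ} (e : RExpr R T)
    (s : Tup (RExpr R) ts) :
    ⋃ i, (Tup.cons (F := RExpr R) e s i).vars = e.vars ∪ ⋃ i, (s i).vars :=
  Tup.iUnion_cons (F := RExpr R) (fun _ e => e.vars) e s

theorem RExpr.iUnion_vars_nil {R : RLang Sg} :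
    ⋃ i, ((Tup.nil : Tup (RExpr R) []) i).vars = ∅ :=
  Tup.iUnion_nil (F := RExpr R) fun _ e => e.vars

theorem RExpr.subst_cons {R : RLang Sg} (θ : RSub R) {T : Sg.Typ} {ts : List Sg.Typ}
    (e : RExpr R T) (s : Tup (RExpr R) ts) :
    (fun i => (Tup.cons (F := RExpr R) e s i).subst θ) =
      Tup.cons (F := RExpr R) (e.subst θ) fun i => (s i).subst θ :=
  Tup.map_cons (F := RExpr R) (G := RExpr R) (fun _ e => e.subst θ) e s

theorem Expr.trans_cons {g : Scope} {T : Sg.Typ} {ts : List Sg.Typ} (e : Expr L g T)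
    (s : Tup (Expr L g) ts) :
    (fun i => (Tup.cons (F := Expr L g) e s i).trans) =
      Tup.cons (F := RExpr L.trans) e.trans fun i => (s i).trans :=
  Tup.map_cons (F := Expr L g) (G := RExpr L.trans) (fun _ e => e.trans) e s

/-! ### Inverting the translation -/

/-- The global expression that is translated into the subscripted variable `a[s]`. -/
def TransArr.toGlob {ts : List Sg.Typ} {T : Sg.Typ} :
    TransArr L ts T → Tup (Expr L Scope.glob) ts → Expr L Scope.glob T
  | .normal a, s => .arr a s
  | .inst x, s => .nav (s 0) x
  | .instArr a, s => .navArr (s 0) a fun i => s i.succ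

/-- A right inverse of the translation of global expressions. An instance variable is always
represented by a navigation expression. -/
def RExpr.toGlob {T : Sg.Typ} : RExpr L.trans T → Expr L Scope.glob T
  | .var x => .var x
  | .arr a s => TransArr.toGlob a fun i => (s i).toGlob
  | .null => .null
  | .tt => .tt
  | .not b => .not b.toGlob
  | .and b c => .and b.toGlob c.toGlob
  | .eq s t => .eq s.toGlob t.toGlob
  | .cond b s t => .cond b.toGlob s.toGlob t.toGlob
  | .fn f s => .fn f fun i => (s i).toGlob

/-- A right inverse of the translation of assertions. -/
def RAssn.toAssn : RAssn L.trans → Assn L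
  | .atom b => .atom b.toGlob
  | .not p => .not p.toAssn
  | .and p q => .and p.toAssn q.toAssn
  | .or p q => .or p.toAssn q.toAssn
  | .ex x p => .ex x p.toAssn
  | .all x p => .all x p.toAssn

/-- The program expression whose translation is the subscripted variable `a[s]`, if there is one;
the object subscript of an instance variable is discarded. -/
def TransArr.toProg {ts : List Sg.Typ} {T : Sg.Typ} :
    TransArr L ts T → Tup (Expr L Scope.prog) ts → Expr L Scope.prog T
  | .normal a, s => .arr a s
  | .inst x, _ => .inst x
  | .instArr a, s => .instArr a fun i => s i.succ

/-- A left inverse of the translation of program expressions. -/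
def RExpr.toProg {T : Sg.Typ} : RExpr L.trans T → Expr L Scope.prog T
  | .var x => .var x
  | .arr a s => TransArr.toProg a fun i => (s i).toProg
  | .null => .null
  | .tt => .tt
  | .not b => .not b.toProg
  | .and b c => .and b.toProg c.toProg
  | .eq s t => .eq s.toProg t.toProg
  | .cond b s t => .cond b.toProg s.toProg t.toProg
  | .fn f s => .fn f fun i => (s i).toProg

theorem TransArr.trans_toGlob {ts : List Sg.Typ} {T : Sg.Typ} (a : TransArr L ts T)
    (s : Tup (Expr L Scope.glob) ts) :
    (a.toGlob s).trans = .arr (R := L.trans) a fun i => (s i).trans := by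
  cases a with
  | normal a => rfl
  | inst x =>
    simp only [TransArr.toGlob, Expr.trans]
    congr 1
    exact Tup.cons_head_nil (F := RExpr L.trans) fun i => (s i).trans
  | instArr a =>
    simp only [TransArr.toGlob, Expr.trans]
    congr 1
    exact Tup.cons_head_tail (F := RExpr L.trans) fun i => (s i).trans

@[simp]
theorem RExpr.trans_toGlob {T : Sg.Typ} (e : RExpr L.trans T) : e.toGlob.trans = e := by
  induction e with
  | arr a s ih => simp only [RExpr.toGlob, TransArr.trans_toGlob, ih]
  | _ => simp only [RExpr.toGlob, Expr.trans, *]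

@[simp]
theorem RAssn.trans_toAssn (p : RAssn L.trans) : p.toAssn.trans = p := by
  induction p <;> simp only [RAssn.toAssn, Assn.trans, RExpr.trans_toGlob, *]

/-- The scope is kept as a variable, since induction on an expression needs a variable index. -/
theorem Expr.toProg_trans_aux {g : Scope} {T : Sg.Typ} (e : Expr L g T) (hg : g = Scope.prog) :
    e.trans.toProg = hg ▸ e := by
  induction e with
  | nav => cases hg
  | navArr => cases hg
  | instArr a s ih =>
    subst hg
    simp only [Expr.trans, RExpr.toProg, TransArr.toProg]
    exact congrArg (Expr.instArr a) (funext fun i => ih i rfl)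
  | _ =>
    subst hg
    simp_all only [Expr.trans, RExpr.toProg, TransArr.toProg, forall_const]

@[simp]
theorem Expr.toProg_trans {T : Sg.Typ} (e : Expr L Scope.prog T) : e.trans.toProg = e :=
  e.toProg_trans_aux rfl

@[simp]
theorem Expr.trans_toGlob {g : Scope} {T : Sg.Typ} (e : Expr L g T) :
    e.toGlob.trans = e.trans := by
  induction e <;> simp only [Expr.toGlob, Expr.trans, *]

theorem Expr.trans_bigAnd : ∀ l : List (Expr L Scope.glob Ty.bool),
    (Expr.bigAnd l).trans = RExpr.bigAnd (l.map Expr.trans)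
  | [] => rfl
  | [_] => rfl
  | b :: c :: bs => by
    simp only [Expr.bigAnd, Expr.trans, List.map, RExpr.bigAnd, Expr.trans_bigAnd (c :: bs)]

/-! ### Variables of translations -/

/-- The variable of the recursive language that a variable is translated into. -/
def AnyVar.trans : AnyVar L → RAnyVar L.trans
  | .var x => .var x
  | .arr a => .arr (R := L.trans) (TransArr.normal a)
  | .inst x => .arr (R := L.trans) (TransArr.inst x)
  | .instArr a => .arr (R := L.trans) (TransArr.instArr a)

theorem AnyVar.trans_injective : Function.Injective (AnyVar.trans (L := L)) := by
  intro v w h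
  cases v <;> cases w <;> simp only [AnyVar.trans] at h <;> cases h <;> rfl

theorem trans_image_tupVars {ts : List Sg.Typ} (x : Tup Sg.Var ts) :
    AnyVar.trans '' tupVars L x = rtupVars L.trans x := by
  rw [tupVars, ← Set.range_comp]
  rfl

theorem Expr.vars_trans {g : Scope} {T : Sg.Typ} (e : Expr L g T) :
    e.trans.vars = AnyVar.trans '' e.vars := by
  induction e <;>
    simp only [Expr.trans, RExpr.vars, Expr.vars, Set.image_union, Set.image_iUnion,
      Set.image_singleton, Set.image_empty, Set.image_insert_eq, AnyVar.trans,
      RExpr.iUnion_vars_cons, RExpr.iUnion_vars_nil,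
      Set.union_empty, *]
  all_goals
    ext
    simp only [Set.mem_union, Set.mem_insert_iff, Set.mem_singleton_iff]
    tauto

theorem Assn.free_trans (p : Assn L) : p.trans.free = AnyVar.trans '' p.free := by
  induction p <;>
    simp only [Assn.trans, RAssn.free, Assn.free, Expr.vars_trans, Set.image_union,
      Set.image_sdiff AnyVar.trans_injective, Set.image_singleton, AnyVar.trans, *]

theorem Loc.vars_trans {T : Sg.Typ} (u : Loc L T) : u.trans.vars = AnyVar.trans '' u.vars := by
  cases u <;>
    simp only [Loc.trans, RLoc.vars, Loc.vars, RExpr.vars, Expr.vars_trans, Set.image_union,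
      Set.image_iUnion, Set.image_singleton, Set.image_insert_eq, AnyVar.trans,
      RExpr.iUnion_vars_cons, RExpr.iUnion_vars_nil,
      Set.union_empty]
  all_goals
    ext
    simp only [Set.mem_union, Set.mem_insert_iff, Set.mem_singleton_iff]
    tauto

theorem Loc.target_trans {T : Sg.Typ} (u : Loc L T) : u.trans.target = u.target.trans := by
  cases u <;> rfl

theorem Stmt.vars_trans (S : Stmt L) : S.trans.vars = AnyVar.trans '' S.vars := by
  induction S <;>
    simp only [Stmt.trans, RStmt.vars, Stmt.vars, RExpr.vars, Expr.vars_trans, Loc.vars_trans,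
      Set.image_union, Set.image_iUnion, Set.image_empty, trans_image_tupVars,
      RExpr.iUnion_vars_cons, Set.union_empty, *]
  rw [← Set.union_assoc, Set.union_self]

theorem Stmt.change_trans (S : Stmt L) : S.trans.change = AnyVar.trans '' S.change := by
  induction S <;>
    simp only [Stmt.trans, RStmt.change, Stmt.change, Loc.target_trans,
      Set.image_union, Set.image_empty, Set.image_singleton, trans_image_tupVars,
      Set.image_sdiff AnyVar.trans_injective, *]

theorem Decls.trans_meth (D : Decls L) {ts : List Sg.Typ} (m : L.Meth ts) :
    D.trans (TransProc.meth m) = (D m).map Decl.trans :=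
  rfl

theorem Decls.vars_trans (D : Decls L) : D.trans.vars = AnyVar.trans '' D.vars := by
  have key : ∀ {ts : List Sg.Typ} (d : Decl L ts),
      rtupVars L.trans d.trans.formals ∪ d.trans.body.vars =
        AnyVar.trans '' ({AnyVar.var L.this} ∪ tupVars L d.formals ∪ d.body.vars) := by
    intro ts d
    simp only [Decl.trans, rtupVars_cons, Stmt.vars_trans, Set.image_union, trans_image_tupVars,
      Set.image_singleton, AnyVar.trans]
  ext v
  constructor
  · rintro ⟨ts, P, d', hd, hv⟩
    cases P with
    | meth m =>
      obtain ⟨d, hd', rfl⟩ := Option.map_eq_some_iff.1 hd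
      rw [key] at hv
      obtain ⟨w, hw, rfl⟩ := hv
      exact ⟨w, ⟨_, m, d, hd', hw⟩, rfl⟩
  · rintro ⟨w, ⟨ts, m, d, hd, hw⟩, rfl⟩
    refine ⟨_, TransProc.meth m, d.trans, by rw [D.trans_meth, hd]; rfl, ?_⟩
    rw [key]
    exact ⟨w, hw, rfl⟩

theorem Decls.change_trans (D : Decls L) : D.trans.change = AnyVar.trans '' D.change := by
  have key : ∀ {ts : List Sg.Typ} (d : Decl L ts),
      d.trans.body.change \ rtupVars L.trans d.trans.formals =
        AnyVar.trans '' (d.body.change \ ({AnyVar.var L.this} ∪ tupVars L d.formals)) := by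
    intro ts d
    simp only [Decl.trans, rtupVars_cons, Stmt.change_trans, Set.image_union, trans_image_tupVars,
      Set.image_singleton, AnyVar.trans, Set.image_sdiff AnyVar.trans_injective]
  ext v
  constructor
  · rintro ⟨ts, P, d', hd, hv⟩
    cases P with
    | meth m =>
      obtain ⟨d, hd', rfl⟩ := Option.map_eq_some_iff.1 hd
      rw [key] at hv
      obtain ⟨w, hw, rfl⟩ := hv
      exact ⟨w, ⟨_, m, d, hd', hw⟩, rfl⟩
  · rintro ⟨w, ⟨ts, m, d, hd, hw⟩, rfl⟩
    refine ⟨_, TransProc.meth m, d.trans, by rw [D.trans_meth, hd]; rfl, ?_⟩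
    rw [key]
    exact ⟨w, hw, rfl⟩

/-! ### Substitution commutes with the translation -/

/-- The translation of the substitution for a subscripted or instance variable. -/
def Upd.trans : Upd L → RUpd L.trans
  | .none => .none
  | .arr a i t => .arr (R := L.trans) (TransArr.normal a) (fun k => (i k).trans) t.trans
  | .inst x t => .arr (R := L.trans) (TransArr.inst x)
      (Tup.cons (F := RExpr L.trans) (.var L.this) Tup.nil) t.trans
  | .instArr a i t => .arr (R := L.trans) (TransArr.instArr a)
      (Tup.cons (F := RExpr L.trans) (.var L.this) fun k => (i k).trans) t.trans

/-- The translation of substitutions. -/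
def Sub.trans (θ : Sub L) : RSub L.trans :=
  ⟨fun _ x => (θ.simple x).trans, θ.upd.trans⟩

theorem Upd.vars_trans (u : Upd L) : u.trans.vars = AnyVar.trans '' u.vars := by
  cases u <;>
    simp only [Upd.trans, RUpd.vars, Upd.vars, RExpr.vars, Expr.vars_trans, Set.image_union,
      Set.image_iUnion, Set.image_singleton, Set.image_insert_eq, AnyVar.trans, Set.image_empty,
      RExpr.iUnion_vars_cons, RExpr.iUnion_vars_nil,
      Set.union_empty]
  all_goals
    ext
    simp only [Set.mem_union, Set.mem_insert_iff, Set.mem_singleton_iff]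
    tauto

theorem Sub.atArr_trans (θ : Sub L) {ts : List Sg.Typ} {T : Sg.Typ} (a : L.Arr ts T)
    (s : Tup (Expr L Scope.glob) ts) :
    (θ.atArr a s).trans = θ.trans.atArr (TransArr.normal a) fun i => (s i).trans := by
  obtain ⟨f, u⟩ := θ
  cases u with
  | none => rfl
  | arr b i t =>
    simp only [Sub.atArr, Sub.trans, Upd.trans, RSub.atArr]
    split_ifs with h₁ h₂ h₂
    · cases h₁
      simp only [cast_eq, Expr.trans, Expr.trans_bigAnd, List.map_ofFn]
      rfl
    · cases h₁
      exact absurd rfl h₂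
    · cases h₂
      exact absurd rfl h₁
    · rfl
  | inst x t =>
    simp only [Sub.atArr, Sub.trans, Upd.trans, RSub.atArr]
    split_ifs with h
    · cases h
    · rfl
  | instArr b i t =>
    simp only [Sub.atArr, Sub.trans, Upd.trans, RSub.atArr]
    split_ifs with h
    · cases h
    · rfl

theorem Sub.atInst_trans (θ : Sub L) {T : Sg.Typ} (e : Expr L Scope.glob Ty.obj) (x : L.IVar T) :
    (θ.atInst e x).trans =
      θ.trans.atArr (TransArr.inst x) (Tup.cons (F := RExpr L.trans) e.trans Tup.nil) := by
  obtain ⟨f, u⟩ := θ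
  cases u with
  | none => rfl
  | arr b i t =>
    simp only [Sub.atInst, Sub.trans, Upd.trans, RSub.atArr]
    split_ifs with h
    · cases h
    · rfl
  | inst y t =>
    simp only [Sub.atInst, Sub.trans, Upd.trans, RSub.atArr]
    split_ifs with h₁ h₂ h₂
    · cases h₁
      rfl
    · cases h₁
      exact absurd rfl h₂
    · cases h₂
      exact absurd rfl h₁
    · rfl
  | instArr b i t =>
    simp only [Sub.atInst, Sub.trans, Upd.trans, RSub.atArr]
    split_ifs with h
    · cases h
    · rfl

theorem Sub.atInstArr_trans (θ : Sub L) {ts : List Sg.Typ} {T : Sg.Typ}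
    (e : Expr L Scope.glob Ty.obj) (a : L.IArr ts T) (s : Tup (Expr L Scope.glob) ts) :
    (θ.atInstArr e a s).trans = θ.trans.atArr (TransArr.instArr a)
      (Tup.cons (F := RExpr L.trans) e.trans fun i => (s i).trans) := by
  obtain ⟨f, u⟩ := θ
  cases u with
  | none => rfl
  | arr b i t =>
    simp only [Sub.atInstArr, Sub.trans, Upd.trans, RSub.atArr]
    split_ifs with h
    · cases h
    · rfl
  | inst y t =>
    simp only [Sub.atInstArr, Sub.trans, Upd.trans, RSub.atArr]
    split_ifs with h
    · cases h
    · rfl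
  | instArr b i t =>
    simp only [Sub.atInstArr, Sub.trans, Upd.trans, RSub.atArr]
    split_ifs with h₁ h₂ h₂
    · cases h₁
      simp only [cast_eq, Expr.trans, Expr.trans_bigAnd, List.map_ofFn, List.map_cons]
      congr 1
      refine congrArg RExpr.bigAnd (Eq.trans ?_ (List.ofFn_succ).symm)
      rfl
    · cases h₁
      exact absurd rfl h₂
    · cases h₂
      exact absurd rfl h₁
    · rfl

theorem Expr.subst_trans (θ : Sub L) {g : Scope} {T : Sg.Typ} (e : Expr L g T) :
    (e.subst θ).trans = e.trans.subst θ.trans := by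
  induction e with
  | var x => rfl
  | arr a s ih => simp only [Expr.subst, Sub.atArr_trans, Expr.trans, RExpr.subst, ih]
  | inst x =>
    simp only [Expr.subst, Sub.atInst_trans, Expr.trans, RExpr.subst]
    congr 1
    funext i
    exact Fin.cases rfl (fun j => j.elim0) i
  | instArr a s ih =>
    simp only [Expr.subst, Sub.atInstArr_trans, Expr.trans, RExpr.subst, ih]
    rw [RExpr.subst_cons]
    rfl
  | nav e x ih =>
    simp only [Expr.subst, Sub.atInst_trans, Expr.trans, RExpr.subst, ih]
    congr 1
    funext i
    exact Fin.cases rfl (fun j => j.elim0) i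
  | navArr e a s ihe ih =>
    simp only [Expr.subst, Sub.atInstArr_trans, Expr.trans, RExpr.subst, ih, ihe]
    rw [RExpr.subst_cons]
  | _ => simp only [Expr.subst, Expr.trans, RExpr.subst, *]

theorem bindOne_map {F G : Sg.Typ → Type} (f : ∀ ⦃U⦄, F U → G U) {T : Sg.Typ} (x : Sg.Var T)
    (v : F T) (h : ∀ ⦃U : Sg.Typ⦄, Sg.Var U → F U) (U : Sg.Typ) (y : Sg.Var U) :
    f (bindOne x v h y) = bindOne (F := G) x (f v) (fun _ z => f (h z)) y := by
  unfold bindOne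
  split_ifs with hxy
  · cases hxy
    rfl
  · rfl

theorem bindMany_map {F G : Sg.Typ → Type} (f : ∀ ⦃U⦄, F U → G U) {ts : List Sg.Typ}
    (x : Tup Sg.Var ts) (v : Tup F ts) (h : ∀ ⦃U : Sg.Typ⦄, Sg.Var U → F U) (U : Sg.Typ)
    (y : Sg.Var U) :
    f (bindMany x v h y) = bindMany (F := G) x (fun i => f (v i)) (fun _ z => f (h z)) y := by
  unfold bindMany
  split_ifs with hxy
  · have key : ∀ (T : Sg.Typ) (z : Sg.Var T) (w : F T) (e : (⟨T, z⟩ : Sg.AnyVar) = ⟨U, y⟩),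
        f (cast (congrArg (fun z : Sg.AnyVar => F z.1) e) w) =
          cast (congrArg (fun z : Sg.AnyVar => G z.1) e) (f w) := by
      intro T z w e
      cases e
      rfl
    exact key _ _ _ hxy.choose_spec
  · rfl

/-- The bound variable chosen by a capture-avoiding substitution only depends on the set of names
to be avoided, and the translation preserves this set. -/
theorem Sub.fresh_trans (θ : Sub L) {T : Sg.Typ} (x : Sg.Var T) (V : Set (AnyVar L)) :
    θ.trans.fresh x (AnyVar.trans '' V) = θ.fresh x V := by
  have avoid : θ.trans.upd.vars ∪ {v | ∃ (U : Sg.Typ) (z : Sg.Var U),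
        RAnyVar.var z ∈ AnyVar.trans '' V ∧ v ∈ (θ.trans.simple z).vars} =
      AnyVar.trans '' (θ.upd.vars ∪ {v | ∃ (U : Sg.Typ) (z : Sg.Var U),
        AnyVar.var z ∈ V ∧ v ∈ (θ.simple z).vars}) := by
    have hV : ∀ (U : Sg.Typ) (z : Sg.Var U),
        RAnyVar.var z ∈ AnyVar.trans '' V ↔ AnyVar.var z ∈ V :=
      fun U z => AnyVar.trans_injective.mem_set_image (a := AnyVar.var z)
    rw [Set.image_union]
    refine congrArg₂ _ (Upd.vars_trans _) ?_
    ext v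
    constructor
    · rintro ⟨U, z, hz, hv⟩
      rw [Sub.trans, Expr.vars_trans] at hv
      obtain ⟨w, hw, rfl⟩ := hv
      exact ⟨w, ⟨U, z, (hV U z).1 hz, hw⟩, rfl⟩
    · rintro ⟨w, ⟨U, z, hz, hw⟩, rfl⟩
      refine ⟨U, z, (hV U z).2 hz, ?_⟩
      rw [Sub.trans, Expr.vars_trans]
      exact ⟨w, hw, rfl⟩
  have hmem : ∀ (y : Sg.Var T) (A : Set (AnyVar L)),
      RAnyVar.var y ∉ AnyVar.trans '' A ↔ AnyVar.var y ∉ A :=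
    fun y A => not_congr (AnyVar.trans_injective.mem_set_image (a := AnyVar.var y))
  simp only [RSub.fresh, Sub.fresh, avoid, hmem]

theorem Sub.rename_trans (θ : Sub L) {T : Sg.Typ} (x y : Sg.Var T) :
    (θ.rename x y).trans = θ.trans.rename x y := by
  simp only [Sub.rename, Sub.trans, RSub.rename]
  congr 1
  funext U z
  exact bindOne_map (F := Expr L Scope.glob) (G := RExpr L.trans) (fun _ e => e.trans) _ _ _ _ _

/-- The two substitutions agree literally, not just up to equivalence, as the same bound variables
are chosen. -/
theorem Assn.subst_trans (p : Assn L) (θ : Sub L) :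
    (p.subst θ).trans = p.trans.subst θ.trans := by
  induction p generalizing θ with
  | ex x p ih | all x p ih =>
    have hV : p.trans.free \ {RAnyVar.var x} = AnyVar.trans '' (p.free \ {AnyVar.var x}) := by
      rw [Assn.free_trans, Set.image_sdiff AnyVar.trans_injective, Set.image_singleton]
      rfl
    simp only [Assn.subst, Assn.trans, RAssn.subst, ih, hV, Sub.fresh_trans, Sub.rename_trans]
  | _ => simp only [Assn.subst, Assn.trans, RAssn.subst, Expr.subst_trans, *]

theorem Sub.one_trans {T : Sg.Typ} (u : Loc L T) (t : Expr L Scope.prog T) :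
    (Sub.one u t).trans = RSub.one u.trans t.trans := by
  cases u with
  | var x =>
    simp only [Sub.one, Sub.trans, Loc.trans, RSub.one, Upd.trans]
    congr 1
    funext U z
    rw [bindOne_map (F := Expr L Scope.glob) (G := RExpr L.trans) (fun _ e => e.trans),
      Expr.trans_toGlob]
    rfl
  | _ => simp only [Sub.one, Sub.trans, Loc.trans, RSub.one, Upd.trans, Expr.trans_toGlob,
      Expr.trans]

theorem Sub.many_trans {ts : List Sg.Typ} (x : Tup Sg.Var ts) (t : Tup (Expr L Scope.glob) ts) :
    (Sub.many x t).trans = RSub.many x fun i => (t i).trans := by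
  simp only [Sub.many, Sub.trans, RSub.many, Upd.trans]
  congr 1
  funext U z
  exact bindMany_map (F := Expr L Scope.glob) (G := RExpr L.trans) (fun _ e => e.trans) _ _ _ _ _

end Translations

/-! ### Semantics of translations -/

section Semantics

variable {Sg : Sig} {L : Lang Sg}

/-- The state of the recursive language that stores the heap in array variables. -/
def State.trans (σ : State L) : RState L.trans where
  var := σ.var
  arr := fun _ _ a v => match a with
    | .normal a => σ.arr a v
    | .inst x => (σ.heap (v 0)).var x
    | .instArr a => (σ.heap (v 0)).arr a fun i => v i.succ

/-- The state whose heap is read off from the array variables of a state of the recursive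
language. -/
def RState.toState (σ : RState L.trans) : State L where
  var := σ.var
  arr := fun _ _ a v => σ.arr (TransArr.normal a) v
  heap := fun o =>
    { var := fun _ x => σ.arr (TransArr.inst x) (Tup.cons (F := Sg.Dom) (T := Ty.obj) o Tup.nil)
      arr := fun _ _ a v => σ.arr (TransArr.instArr a) (Tup.cons (F := Sg.Dom) (T := Ty.obj) o v) }

@[simp]
theorem RState.trans_toState (σ : RState L.trans) : σ.toState.trans = σ := by
  obtain ⟨f, g⟩ := σ
  simp only [RState.toState, State.trans]
  congr 1
  funext ts T a v
  cases a with
  | normal a => rfl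
  | inst x => exact congrArg (g (TransArr.inst x)) (Tup.cons_head_nil (F := Sg.Dom) v)
  | instArr a => exact congrArg (g (TransArr.instArr a)) (Tup.cons_head_tail (F := Sg.Dom) v)

@[simp]
theorem Expr.eval_trans {g : Scope} {T : Sg.Typ} (e : Expr L g T) (σ : State L) :
    e.trans.eval σ.trans = e.eval σ := by
  induction e with
  | var => rfl
  | arr a s ih => simp only [Expr.trans, RExpr.eval, Expr.eval, ih]; rfl
  | inst x => rfl
  | instArr a s ih => exact congrArg ((σ.heap (σ.var L.this)).arr a) (funext ih)
  | nav e x ih => exact congrArg (fun o => (σ.heap o).var x) ih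
  | navArr e a s ihe ih =>
    exact congrArg₂ (fun o v => (σ.heap o).arr a v) ihe (funext ih)
  | _ => simp only [Expr.trans, RExpr.eval, Expr.eval, *]

theorem Expr.isTrue_trans {g : Scope} (B : Expr L g Ty.bool) (σ : State L) :
    B.trans.IsTrue σ.trans ↔ B.IsTrue σ := by
  rw [RExpr.IsTrue, Expr.IsTrue, Expr.eval_trans]

theorem State.setVar_trans (σ : State L) {T : Sg.Typ} (x : Sg.Var T) (d : Sg.Dom T) :
    (σ.setVar x d).trans = σ.trans.setVar x d :=
  rfl

theorem State.setVars_trans (σ : State L) {ts : List Sg.Typ} (x : Tup Sg.Var ts)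
    (d : Tup Sg.Dom ts) : (σ.setVars x d).trans = σ.trans.setVars x d :=
  rfl

@[simp]
theorem Assn.sat_trans (p : Assn L) (σ : State L) : p.trans.Sat σ.trans ↔ p.Sat σ := by
  induction p generalizing σ <;>
    simp only [Assn.trans, RAssn.Sat, Assn.Sat, Expr.isTrue_trans, ← State.setVar_trans, *]

theorem Assn.implies_trans {p q : Assn L} : p.trans.Implies q.trans ↔ p.Implies q := by
  constructor
  · intro h σ hp
    exact (q.sat_trans σ).1 (h _ ((p.sat_trans σ).2 hp))
  · intro h σ hp
    rw [← σ.trans_toState, Assn.sat_trans] at hp ⊢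
    exact h _ hp

theorem updArr_self {A : List Sg.Typ → Sg.Typ → Type}
    (f : ∀ ⦃ts : List Sg.Typ⦄ ⦃T : Sg.Typ⦄, A ts T → Tup Sg.Dom ts → Sg.Dom T)
    {ts : List Sg.Typ} {T : Sg.Typ} (a : A ts T) (v : Tup Sg.Dom ts) (d : Sg.Dom T)
    (w : Tup Sg.Dom ts) : updArr f a v d a w = if v = w then d else f a w :=
  dif_pos rfl

theorem updArr_of_ne {A : List Sg.Typ → Sg.Typ → Type}
    (f : ∀ ⦃ts : List Sg.Typ⦄ ⦃T : Sg.Typ⦄, A ts T → Tup Sg.Dom ts → Sg.Dom T)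
    {ts : List Sg.Typ} {T : Sg.Typ} (a : A ts T) (v : Tup Sg.Dom ts) (d : Sg.Dom T)
    {us : List Sg.Typ} {U : Sg.Typ} (b : A us U) (w : Tup Sg.Dom us)
    (h : (⟨ts, T, a⟩ : Σ us : List Sg.Typ, Σ U : Sg.Typ, A us U) ≠ ⟨us, U, b⟩) :
    updArr f a v d b w = f b w :=
  dif_neg h

theorem State.setLocal_heap_ne (σ : State L) {o o' : Sg.Obj} (τ : LocalState L) (h : o' ≠ o) :
    (σ.setLocal o τ).heap o' = σ.heap o' :=
  if_neg h

theorem State.setLocal_heap_self (σ : State L) (o : Sg.Obj) (τ : LocalState L) :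
    (σ.setLocal o τ).heap o = τ :=
  if_pos rfl

theorem State.setArr_trans (σ : State L) {ts : List Sg.Typ} {T : Sg.Typ} (a : L.Arr ts T)
    (v : Tup Sg.Dom ts) (d : Sg.Dom T) :
    ({ σ with arr := updArr (A := L.Arr) σ.arr a v d } : State L).trans =
      { σ.trans with
        arr := updArr (A := L.trans.Arr) σ.trans.arr (TransArr.normal a) v d } := by
  simp only [State.trans]
  congr 1
  funext us U b w
  cases b with
  | normal b =>
    by_cases h : (⟨ts, T, a⟩ : Σ us : List Sg.Typ, Σ U : Sg.Typ, L.Arr us U) = ⟨us, U, b⟩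
    · cases h
      rw [updArr_self _ (TransArr.normal a)]
      exact updArr_self σ.arr a v d w
    · rw [updArr_of_ne _ (TransArr.normal a)]
      · exact updArr_of_ne σ.arr a v d b w h
      · intro h'
        cases h'
        exact h rfl
  | inst y =>
    rw [updArr_of_ne]
    intro h
    cases h
  | instArr b =>
    rw [updArr_of_ne]
    intro h
    cases h

theorem State.setInst_trans (σ : State L) (o : Sg.Obj) {T : Sg.Typ} (x : L.IVar T)
    (d : Sg.Dom T) :
    (σ.setLocal o ((σ.heap o).setVar x d)).trans =
      { σ.trans with
        arr := updArr (A := L.trans.Arr) σ.trans.arr (TransArr.inst x)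
          (Tup.cons (F := Sg.Dom) (T := Ty.obj) o Tup.nil) d } := by
  simp only [State.trans]
  congr 1
  funext us U b w
  cases b with
  | normal b =>
    rw [updArr_of_ne]
    · rfl
    · intro h
      cases h
  | inst y =>
    by_cases h : (⟨T, x⟩ : Σ U : Sg.Typ, L.IVar U) = ⟨U, y⟩
    · cases h
      rw [updArr_self]
      by_cases ho : w 0 = o
      · have hw : Tup.cons (F := Sg.Dom) (T := Ty.obj) o Tup.nil = w := by
          rw [← ho]
          exact Tup.cons_head_nil w
        rw [if_pos hw]
        simp only [ho, State.setLocal_heap_self]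
        exact dif_pos rfl
      · have hw : Tup.cons (F := Sg.Dom) (T := Ty.obj) o Tup.nil ≠ w :=
          fun h => ho (congrFun h 0).symm
        rw [if_neg hw]
        simp only [σ.setLocal_heap_ne _ ho]
    · rw [updArr_of_ne]
      · by_cases ho : w 0 = o
        · simp only [ho, State.setLocal_heap_self]
          exact dif_neg h
        · simp only [σ.setLocal_heap_ne _ ho]
      · intro h'
        cases h'
        exact h rfl
  | instArr b =>
    rw [updArr_of_ne]
    · by_cases ho : w 0 = o
      · simp only [ho, State.setLocal_heap_self]
        rfl
      · simp only [σ.setLocal_heap_ne _ ho]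
    · intro h
      cases h

theorem State.setInstArr_trans (σ : State L) (o : Sg.Obj) {ts : List Sg.Typ} {T : Sg.Typ}
    (a : L.IArr ts T) (v : Tup Sg.Dom ts) (d : Sg.Dom T) :
    (σ.setLocal o ((σ.heap o).setArr a v d)).trans =
      { σ.trans with
        arr := updArr (A := L.trans.Arr) σ.trans.arr (TransArr.instArr a)
          (Tup.cons (F := Sg.Dom) (T := Ty.obj) o v) d } := by
  simp only [State.trans]
  congr 1
  funext us U b w
  cases b with
  | normal b =>
    rw [updArr_of_ne]
    · rfl
    · intro h
      cases h
  | inst y =>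
    rw [updArr_of_ne]
    · by_cases ho : w 0 = o
      · simp only [ho, State.setLocal_heap_self]
        rfl
      · simp only [σ.setLocal_heap_ne _ ho]
    · intro h
      cases h
  | @instArr us U b =>
    by_cases h : (⟨ts, T, a⟩ : Σ us : List Sg.Typ, Σ U : Sg.Typ, L.IArr us U) = ⟨us, U, b⟩
    · cases h
      rw [updArr_self]
      by_cases ho : w 0 = o
      · simp only [ho, State.setLocal_heap_self]
        simp only [LocalState.setArr]
        rw [updArr_self]
        refine if_congr ?_ rfl rfl
        rw [← ho]
        constructor
        · rintro rfl
          exact Tup.cons_head_tail (F := Sg.Dom) w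
        · intro h
          exact funext fun i => congrFun h i.succ
      · have hw : Tup.cons (F := Sg.Dom) (T := Ty.obj) o v ≠ w :=
          fun h => ho (congrFun h 0).symm
        rw [if_neg hw]
        simp only [σ.setLocal_heap_ne _ ho]
    · rw [updArr_of_ne]
      · by_cases ho : w 0 = o
        · simp only [ho, State.setLocal_heap_self]
          simp only [LocalState.setArr]
          rw [updArr_of_ne _ _ _ _ _ _ h]
        · simp only [σ.setLocal_heap_ne _ ho]
      · intro h'
        cases h'
        exact h rfl

theorem RExpr.eval_cons {R : RLang Sg} (σ : RState R) {T : Sg.Typ} {ts : List Sg.Typ}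
    (e : RExpr R T) (s : Tup (RExpr R) ts) :
    (fun i => (Tup.cons (F := RExpr R) e s i).eval σ) =
      Tup.cons (F := Sg.Dom) (e.eval σ) fun i => (s i).eval σ :=
  Tup.map_cons (F := RExpr R) (G := Sg.Dom) (fun _ e => e.eval σ) e s

theorem State.set_trans (σ : State L) {T : Sg.Typ} (u : Loc L T) (d : Sg.Dom T) :
    (σ.set u d).trans = σ.trans.set u.trans d := by
  cases u with
  | var x => rfl
  | arr a s =>
    simp only [State.set, setArr_trans, RState.set, Loc.trans, Expr.eval_trans]
  | inst x =>
    simp only [State.set, setInst_trans, RState.set, Loc.trans]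
    rw [RExpr.eval_cons]
    congr 3
    exact funext fun i => i.elim0
  | instArr a s =>
    simp only [State.set, setInstArr_trans, RState.set, Loc.trans]
    rw [RExpr.eval_cons]
    simp only [Expr.eval_trans]
    rfl

/-- The coincidence lemma: the value of an expression does not depend on other variables. -/
theorem RExpr.eval_setVar {R : RLang Sg} {T : Sg.Typ} (e : RExpr R T) {U : Sg.Typ} {x : Sg.Var U}
    (hx : RAnyVar.var x ∉ e.vars) (σ : RState R) (d : Sg.Dom U) :
    e.eval (σ.setVar x d) = e.eval σ := by
  induction e with
  | var y =>
    refine dif_neg fun h => hx ?_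
    cases h
    rfl
  | arr a s ih =>
    simp only [RExpr.vars, Set.mem_union, Set.mem_iUnion, not_or, not_exists] at hx
    simp only [RExpr.eval, ih _ (hx.2 _)]
    rfl
  | fn f s ih =>
    simp only [RExpr.vars, Set.mem_iUnion, not_exists] at hx
    simp only [RExpr.eval, ih _ (hx _)]
  | _ =>
    simp only [RExpr.vars, Set.mem_union, not_or] at hx
    simp only [RExpr.eval, *, not_false_eq_true]

theorem RExpr.subst_many_eq_self {R : RLang Sg} {ts : List Sg.Typ} {z : Tup Sg.Var ts}
    (t : Tup (RExpr R) ts) {T : Sg.Typ} (e : RExpr R T) (hz : rtupVars R z ∩ e.vars = ∅) :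
    e.subst (RSub.many z t) = e := by
  induction e with
  | var y =>
    refine dif_neg fun ⟨i, h⟩ => ?_
    have : RAnyVar.var y ∈ rtupVars R z ∩ {RAnyVar.var y} := by
      refine ⟨⟨i, ?_⟩, rfl⟩
      exact congrArg (fun v : Sg.AnyVar => (RAnyVar.var v.2 : RAnyVar R)) h
    rw [RExpr.vars] at hz
    rw [hz] at this
    exact this
  | arr a s ih =>
    simp only [RExpr.vars, Set.inter_union_distrib_left, Set.inter_iUnion, Set.union_empty_iff,
      Set.iUnion_eq_empty] at hz
    simp only [RExpr.subst, ih _ (hz.2 _)]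
    rfl
  | fn f s ih =>
    simp only [RExpr.vars, Set.inter_iUnion, Set.iUnion_eq_empty] at hz
    simp only [RExpr.subst, ih _ (hz _)]
  | _ =>
    simp only [RExpr.vars, Set.inter_union_distrib_left, Set.union_empty_iff] at hz
    simp only [RExpr.subst, *]

end Semantics

/-! ### Translating derivations -/

section Derivations

variable {Sg : Sig} {L : Lang Sg}

/-- The procedure call that is guarded by `Θ(s) ≠ null` in the translation of `s.m(t)`. -/
def transCall {ts : List Sg.Typ} (s : Expr L Scope.prog Ty.obj) (m : L.Meth ts)
    (t : Tup (Expr L Scope.prog) ts) : RStmt L.trans :=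
  .call (R := L.trans) (TransProc.meth m)
    (Tup.cons (F := RExpr L.trans) s.trans fun i => (t i).trans)

/-- `TransRel S S' G`: under the condition `G`, the statement `S'` does the same as `S`. Either
`S'` is the translation of `S`, and there is no condition, or `S` is a method call `s.m(t)`, `S'` is
the procedure call inside its translation, and the condition is `s ≠ null`. Procedure calls have to
be covered because they are substatements of translations without being translations. -/
def TransRel (S : Stmt L) (S' : RStmt L.trans) (G : Expr L Scope.prog Ty.bool) : Prop :=
  (S' = S.trans ∧ G = .tt) ∨
    ∃ (ts : List Sg.Typ) (s : Expr L Scope.prog Ty.obj) (m : L.Meth ts)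
      (t : Tup (Expr L Scope.prog) ts), S = .call s m t ∧ S' = transCall s m t ∧ G = s.neNull

theorem TransRel.trans (S : Stmt L) : TransRel S S.trans .tt :=
  Or.inl ⟨rfl, rfl⟩

theorem TransRel.call {ts : List Sg.Typ} (s : Expr L Scope.prog Ty.obj) (m : L.Meth ts)
    (t : Tup (Expr L Scope.prog) ts) : TransRel (.call s m t) (transCall s m t) s.neNull :=
  Or.inr ⟨ts, s, m, t, rfl, rfl, rfl⟩

theorem transCall_vars {ts : List Sg.Typ} (s : Expr L Scope.prog Ty.obj) (m : L.Meth ts)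
    (t : Tup (Expr L Scope.prog) ts) :
    (transCall s m t).vars = AnyVar.trans '' (Stmt.call s m t).vars := by
  simp only [transCall, RStmt.vars, RExpr.iUnion_vars_cons, Expr.vars_trans, Stmt.vars,
    Set.image_union, Set.image_iUnion]

theorem TransRel.vars_eq {S : Stmt L} {S' : RStmt L.trans} {G : Expr L Scope.prog Ty.bool}
    (h : TransRel S S' G) : S'.vars = AnyVar.trans '' S.vars := by
  obtain ⟨rfl, -⟩ | ⟨ts, s, m, t, rfl, rfl, -⟩ := h
  · exact S.vars_trans
  · exact transCall_vars s m t

theorem TransRel.change_eq {S : Stmt L} {S' : RStmt L.trans} {G : Expr L Scope.prog Ty.bool}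
    (h : TransRel S S' G) : S'.change = AnyVar.trans '' S.change := by
  obtain ⟨rfl, -⟩ | ⟨ts, s, m, t, rfl, rfl, -⟩ := h
  · exact S.change_trans
  · simp only [transCall, RStmt.change, Stmt.change, Set.image_empty]

theorem TransRel.guard_vars {S : Stmt L} {S' : RStmt L.trans} {G : Expr L Scope.prog Ty.bool}
    (h : TransRel S S' G) : G.trans.vars ⊆ S'.vars := by
  obtain ⟨-, rfl⟩ | ⟨ts, s, m, t, rfl, rfl, rfl⟩ := h
  · exact Set.empty_subset _
  · simp only [Expr.neNull, Expr.trans, RExpr.vars, Set.union_empty, transCall, RStmt.vars,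
      RExpr.iUnion_vars_cons, Set.subset_union_left]

theorem Decl.inline_trans {ts : List Sg.Typ} (d : Decl L ts) (s : Expr L Scope.prog Ty.obj)
    (t : Tup (Expr L Scope.prog) ts) :
    (d.inline s t).trans =
      d.trans.inline (Tup.cons (F := RExpr L.trans) s.trans fun i => (t i).trans) := by
  simp only [Decl.inline, Stmt.trans, RDecl.inline, Decl.trans]
  rw [Expr.trans_cons]

theorem Assn.ofExpr_trans (B : Expr L Scope.prog Ty.bool) :
    (Assn.ofExpr B).trans = .atom B.trans := by
  rw [Assn.ofExpr, Assn.trans, Expr.trans_toGlob]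

theorem sat_atom_tt (σ : RState L.trans) :
    (RAssn.atom (Expr.tt (L := L) (g := Scope.prog)).trans).Sat σ :=
  rfl

theorem RDeriv.strengthen_pre {R : RLang Sg} {D : RDecls R} {μ : Mode} {A : Set (RFormula R)}
    {p p₂ q : RAssn R} {S : RStmt R} (h : RDeriv D μ A p S q) (hp : p₂.Implies p) :
    RDeriv D μ A p₂ S q :=
  .consequence hp h fun _ => id

theorem Deriv.consequence_trans {D : Decls L} {μ : Mode} {A : Set (Formula L)}
    {p p₂ q q₂ : Assn L} {S : Stmt L} (h : Deriv D μ A p S q) (hp : p₂.trans.Implies p.trans)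
    (hq : q.trans.Implies q₂.trans) : Deriv D μ A p₂ S q₂ :=
  .consequence (Assn.implies_trans.1 hp) h (Assn.implies_trans.1 hq)

theorem tupVars_inter_trans {ts : List Sg.Typ} (x : Tup Sg.Var ts) (V : Set (AnyVar L)) :
    rtupVars L.trans x ∩ AnyVar.trans '' V = ∅ ↔ tupVars L x ∩ V = ∅ := by
  rw [← trans_image_tupVars, ← Set.image_inter AnyVar.trans_injective, Set.image_eq_empty]

theorem var_mem_image_trans {T : Sg.Typ} (x : Sg.Var T) (V : Set (AnyVar L)) :
    RAnyVar.var x ∈ AnyVar.trans '' V ↔ AnyVar.var x ∈ V :=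
  AnyVar.trans_injective.mem_set_image (a := AnyVar.var x)

/-- Every derivation about object-oriented programs can be translated rule by rule. A weakening step
becomes an application of the failure rule to the procedure call. -/
theorem Deriv.trans {D : Decls L} {μ : Mode} {A : Set (Formula L)} {A' : Set (RFormula L.trans)}
    (hA : ∀ f ∈ A, ∀ S' G, TransRel f.stmt S' G →
      RDeriv D.trans μ A' (.and f.pre.trans (.atom G.trans)) S' f.post.trans)
    {p q : Assn L} {S : Stmt L} (h : Deriv D μ A p S q) :
    ∀ S' G, TransRel S S' G →
      RDeriv D.trans μ A' (.and p.trans (.atom G.trans)) S' q.trans := by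
  induction h with
  | hyp h => exact hA _ h
  | skip p =>
    rintro _ _ (⟨rfl, rfl⟩ | ⟨_, _, _, _, h, -⟩)
    · exact (RDeriv.skip _).strengthen_pre fun _ h => h.1
    · cases h
  | assign p u t =>
    rintro _ _ (⟨rfl, rfl⟩ | ⟨_, _, _, _, h, -⟩)
    · refine (RDeriv.assign p.trans u.trans t.trans).strengthen_pre fun _ h => ?_
      rw [← Sub.one_trans, ← Assn.subst_trans]
      exact h.1
    · cases h
  | passign p x t =>
    rintro _ _ (⟨rfl, rfl⟩ | ⟨_, _, _, _, h, -⟩)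
    · refine (RDeriv.passign p.trans x fun i => (t i).trans).strengthen_pre fun _ h => ?_
      have h := h.1
      simp only [Assn.subst_trans, Sub.many_trans, Expr.trans_toGlob] at h
      exact h
    · cases h
  | comp _ _ ih₁ ih₂ =>
    rintro _ _ (⟨rfl, rfl⟩ | ⟨_, _, _, _, h, -⟩)
    · exact .comp (ih₁ _ _ (.trans _))
        ((ih₂ _ _ (.trans _)).strengthen_pre fun _ h => ⟨h, sat_atom_tt _⟩)
    · cases h
  | cond _ _ ih₁ ih₂ =>
    rintro _ _ (⟨rfl, rfl⟩ | ⟨_, _, _, _, h, -⟩)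
    · have ih₁ := ih₁ _ _ (.trans _)
      have ih₂ := ih₂ _ _ (.trans _)
      simp only [Assn.trans, Assn.ofExpr_trans] at ih₁ ih₂
      exact .cond (ih₁.strengthen_pre fun _ h => ⟨⟨h.1.1, h.2⟩, h.1.2⟩)
        (ih₂.strengthen_pre fun _ h => ⟨⟨h.1.1, h.2⟩, h.1.2⟩)
    · cases h
  | loop _ ih =>
    rintro _ _ (⟨rfl, rfl⟩ | ⟨_, _, _, _, h, -⟩)
    · have ih := ih _ _ (.trans _)
      simp only [Assn.trans, Assn.ofExpr_trans] at ih ⊢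
      exact (RDeriv.loop (ih.strengthen_pre fun _ h => ⟨h, sat_atom_tt _⟩)).strengthen_pre
        fun _ h => h.1
    · cases h
  | @consequence p p₁ q₁ q S hp _ hq ih =>
    intro S' G hS
    exact .consequence (p₁ := .and p₁.trans (.atom G.trans))
      (fun σ h => ⟨Assn.implies_trans.2 hp σ h.1, h.2⟩) (ih S' G hS) (Assn.implies_trans.2 hq)
  | failure hμ _ ih =>
    rintro _ _ (⟨rfl, rfl⟩ | ⟨_, _, _, _, h, -⟩)
    · have ih := ih _ _ (.trans _)
      simp only [Assn.trans, Assn.ofExpr_trans] at ih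
      exact .failure hμ (ih.strengthen_pre fun _ h => ⟨⟨h.1.1, h.2⟩, h.1.2⟩)
    · cases h
  | failureII hμ hB _ ih =>
    rintro _ _ (⟨rfl, rfl⟩ | ⟨_, _, _, _, h, -⟩)
    · refine .failureII hμ (fun σ h => ?_) (ih _ _ (.trans _))
      have hB := Assn.implies_trans.2 hB σ h.1
      rwa [Assn.ofExpr_trans] at hB
    · cases h
  | block _ hx ih =>
    rintro _ _ (⟨rfl, rfl⟩ | ⟨_, _, _, _, h, -⟩)
    · refine .block (ih _ _ (.trans _)) ?_
      rwa [Assn.free_trans, tupVars_inter_trans]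
    · cases h
  | disjunction _ _ ih₁ ih₂ =>
    intro S' G hS
    refine (RDeriv.disjunction (ih₁ S' G hS) (ih₂ S' G hS)).strengthen_pre ?_
    rintro σ ⟨h | h, hG⟩
    · exact Or.inl ⟨h, hG⟩
    · exact Or.inr ⟨h, hG⟩
  | conjunction _ _ ih₁ ih₂ =>
    intro S' G hS
    exact (RDeriv.conjunction (ih₁ S' G hS) (ih₂ S' G hS)).strengthen_pre
      fun _ h => ⟨⟨h.1.1, h.2⟩, ⟨h.1.2, h.2⟩⟩
  | @exIntro p q S T x _ hx ih =>
    intro S' G hS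
    have hx' : RAnyVar.var x ∉ D.trans.vars ∪ S'.vars ∪ q.trans.free := by
      rwa [Decls.vars_trans, hS.vars_eq, Assn.free_trans, ← Set.image_union, ← Set.image_union,
        var_mem_image_trans]
    refine (RDeriv.exIntro (ih S' G hS) hx').strengthen_pre ?_
    rintro σ ⟨⟨d, hd⟩, hG⟩
    refine ⟨d, hd, ?_⟩
    -- The guard only involves variables of the program, so it does not depend on `x`.
    have : RAnyVar.var x ∉ G.trans.vars := fun h => hx' (Or.inl (Or.inr (hS.guard_vars h)))
    exact (RExpr.eval_setVar _ this σ d).trans hG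
  | invariance _ hp ih =>
    intro S' G hS
    refine (RDeriv.invariance (ih S' G hS) ?_).strengthen_pre
      fun _ h => ⟨h.1.1, h.1.2, h.2⟩
    rw [Assn.free_trans, Decls.change_trans, hS.change_eq, ← Set.image_union,
      ← Set.image_inter AnyVar.trans_injective, hp, Set.image_empty]
  | @substitution p q S ts z t _ hz hzv ht ih =>
    intro S' G hS
    have hzv' : rtupVars L.trans z ∩ (D.trans.vars ∪ S'.vars) = ∅ := by
      rwa [Decls.vars_trans, hS.vars_eq, ← Set.image_union, tupVars_inter_trans]
    have key := RDeriv.substitution (t := fun i => (t i).trans) (ih S' G hS) hz hzv' (by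
      simp only [Expr.vars_trans]
      rw [← Set.image_iUnion, Decls.change_trans, hS.change_eq, ← Set.image_union,
        ← Set.image_inter AnyVar.trans_injective, ht, Set.image_empty])
    -- The guard only involves variables of the program, so the substitution leaves it unchanged.
    have hG : rtupVars L.trans z ∩ G.trans.vars = ∅ :=
      Set.subset_empty_iff.1 (hzv' ▸ Set.inter_subset_inter_right _
        (hS.guard_vars.trans Set.subset_union_right))
    rw [RAssn.subst, RAssn.subst, RExpr.subst_many_eq_self _ _ hG, ← Sub.many_trans,
      ← Assn.subst_trans, ← Assn.subst_trans] at key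
    exact key
  | @weakening p q ts s m t hμ _ ih =>
    -- The premise is used for the bare procedure call, to which the failure rule applies.
    have key : RDeriv D.trans μ A' (.and p.trans (.atom s.neNull.trans)) (transCall s m t)
        q.trans := by
      have ih := ih _ _ (.call s m t)
      simp only [Assn.trans, Assn.ofExpr_trans] at ih
      exact ih.strengthen_pre fun _ h => ⟨h, h.2⟩
    rintro _ _ (⟨rfl, rfl⟩ | ⟨_, _, _, _, h, rfl, rfl⟩)
    · exact .failure hμ (key.strengthen_pre fun _ h => ⟨h.1.1, h.2⟩)
    · cases h
      exact key

/-- Every derivation about translated programs comes, rule by rule, from one about object-oriented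
programs. An application of the failure rule to a procedure call becomes a weakening step. -/
theorem RDeriv.toDeriv {D : Decls L} {μ : Mode} {A : Set (Formula L)}
    {A' : Set (RFormula L.trans)}
    (hA : ∀ f ∈ A', ∀ S G, TransRel S f.stmt G →
      Deriv D μ A (.and f.pre.toAssn (.ofExpr G)) S f.post.toAssn)
    {p q : RAssn L.trans} {S' : RStmt L.trans} (h : RDeriv D.trans μ A' p S' q) :
    ∀ S G, TransRel S S' G → Deriv D μ A (.and p.toAssn (.ofExpr G)) S q.toAssn := by
  have tt_sat : ∀ σ : RState L.trans,
      ((Assn.ofExpr (L := L) .tt).trans).Sat σ := fun _ => rfl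
  induction h with
  | hyp h => exact hA _ h
  | skip p =>
    rintro S _ (⟨h, rfl⟩ | ⟨_, _, _, _, -, h, -⟩)
    · cases S <;> cases h
      exact (Deriv.skip _).consequence_trans (fun _ h => h.1) fun _ => id
    · cases h
  | assign p u t =>
    rintro S _ (⟨h, rfl⟩ | ⟨_, _, _, _, -, h, -⟩)
    · cases S <;> cases h
      refine (Deriv.assign p.toAssn _ _).consequence_trans (fun _ h => ?_) fun _ => id
      have h := h.1
      simp only [RAssn.trans_toAssn] at h
      rwa [Assn.subst_trans, Sub.one_trans, RAssn.trans_toAssn]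
    · cases h
  | passign p x t =>
    rintro S _ (⟨h, rfl⟩ | ⟨_, _, _, _, -, h, -⟩)
    · cases S <;> cases h
      refine (Deriv.passign p.toAssn _ _).consequence_trans (fun _ h => ?_) fun _ => id
      have h := h.1
      simp only [RAssn.trans_toAssn] at h
      simpa only [Assn.subst_trans, Sub.many_trans, RAssn.trans_toAssn, Expr.trans_toGlob] using h
    · cases h
  | comp _ _ ih₁ ih₂ =>
    rintro S _ (⟨h, rfl⟩ | ⟨_, _, _, _, -, h, -⟩)
    · cases S <;> cases h
      exact .comp (ih₁ _ _ (.trans _))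
        ((ih₂ _ _ (.trans _)).consequence_trans (fun _ h => ⟨h, tt_sat _⟩) fun _ => id)
    · cases h
  | cond _ _ ih₁ ih₂ =>
    rintro S _ (⟨h, rfl⟩ | ⟨_, _, _, _, -, h, -⟩)
    · cases S <;> cases h
      refine .cond ((ih₁ _ _ (.trans _)).consequence_trans ?_ fun _ => id)
        ((ih₂ _ _ (.trans _)).consequence_trans ?_ fun _ => id) <;>
      · simp only [Assn.trans, RAssn.trans_toAssn, Assn.ofExpr_trans]
        exact fun _ h => ⟨⟨h.1.1, h.2⟩, h.1.2⟩
    · cases h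
  | loop _ ih =>
    rintro S _ (⟨h, rfl⟩ | ⟨_, _, _, _, -, h, -⟩)
    · cases S <;> cases h
      refine (Deriv.loop ((ih _ _ (.trans _)).consequence_trans ?_ fun _ => id)).consequence_trans
        (fun _ h => h.1) ?_ <;>
      simp only [Assn.trans, RAssn.trans_toAssn, Assn.ofExpr_trans]
      · exact fun _ h => ⟨h, sat_atom_tt _⟩
      · exact fun _ => id
    · cases h
  | consequence hp _ hq ih =>
    intro S G hS
    refine (ih S G hS).consequence_trans ?_ ?_ <;> simp only [Assn.trans, RAssn.trans_toAssn]
    · exact fun σ h => ⟨hp σ h.1, h.2⟩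
    · exact hq
  | failure hμ _ ih =>
    rintro S _ (⟨h, rfl⟩ | ⟨_, _, _, _, -, h, -⟩)
    · cases S <;> cases h
      · refine .failure hμ ((ih _ _ (.trans _)).consequence_trans ?_ fun _ => id)
        simp only [Assn.trans, RAssn.trans_toAssn, Assn.ofExpr_trans]
        exact fun _ h => ⟨⟨h.1.1, h.2⟩, h.1.2⟩
      · refine .weakening hμ ((ih _ _ (.call _ _ _)).consequence_trans ?_ fun _ => id)
        simp only [Assn.trans, RAssn.trans_toAssn, Assn.ofExpr_trans]
        exact fun _ h => ⟨⟨h.1.1, h.2⟩, h.2⟩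
    · cases h
  | failureII hμ hB _ ih =>
    rintro S _ (⟨h, rfl⟩ | ⟨_, _, _, _, -, h, -⟩)
    · cases S <;> cases h
      · refine .failureII hμ (Assn.implies_trans.1 ?_) (ih _ _ (.trans _))
        simp only [Assn.trans, RAssn.trans_toAssn, Assn.ofExpr_trans]
        exact fun σ h => hB σ h.1
      · refine (ih _ _ (.call _ _ _)).consequence_trans ?_ fun _ => id
        simp only [Assn.trans, RAssn.trans_toAssn, Assn.ofExpr_trans]
        exact fun σ h => ⟨h.1, hB σ h.1⟩
    · cases h
  | @block p q _ x _ _ _ hx ih =>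
    rintro S _ (⟨h, rfl⟩ | ⟨_, _, _, _, -, h, -⟩)
    · cases S <;> cases h
      refine .block (ih (.seq (.passign _ _) _) _ (.trans _)) ?_
      rwa [← tupVars_inter_trans, ← Assn.free_trans, RAssn.trans_toAssn]
    · cases h
  | disjunction _ _ ih₁ ih₂ =>
    intro S G hS
    refine (Deriv.disjunction (ih₁ S G hS) (ih₂ S G hS)).consequence_trans ?_ fun _ => id
    rintro σ ⟨h | h, hG⟩
    · exact Or.inl ⟨h, hG⟩
    · exact Or.inr ⟨h, hG⟩
  | conjunction _ _ ih₁ ih₂ =>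
    intro S G hS
    exact (Deriv.conjunction (ih₁ S G hS) (ih₂ S G hS)).consequence_trans
      (fun _ h => ⟨⟨h.1.1, h.2⟩, ⟨h.1.2, h.2⟩⟩) fun _ => id
  | @exIntro p q S' T x _ hx ih =>
    intro S G hS
    have hx' : AnyVar.var x ∉ D.vars ∪ S.vars ∪ q.toAssn.free := by
      rwa [← var_mem_image_trans, Set.image_union, Set.image_union, ← Decls.vars_trans,
        ← hS.vars_eq, ← Assn.free_trans, RAssn.trans_toAssn]
    refine (Deriv.exIntro (ih S G hS) hx').consequence_trans ?_ fun _ => id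
    rintro σ ⟨⟨d, hd⟩, hG⟩
    refine ⟨d, hd, ?_⟩
    have : RAnyVar.var x ∉ G.trans.vars := fun h => hx (Or.inl (Or.inr (hS.guard_vars h)))
    rw [Assn.ofExpr_trans] at hG ⊢
    exact (RExpr.eval_setVar _ this σ d).trans hG
  | @invariance p r q S' _ hp ih =>
    intro S G hS
    refine (Deriv.invariance (p := p.toAssn) (ih S G hS) ?_).consequence_trans
      (fun _ h => ⟨h.1.1, h.1.2, h.2⟩) fun _ => id
    rw [← Set.image_eq_empty (f := AnyVar.trans), Set.image_inter AnyVar.trans_injective,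
      Set.image_union, ← Decls.change_trans, ← hS.change_eq, ← Assn.free_trans,
      RAssn.trans_toAssn, hp]
  | @substitution p q S' ts z t _ hz hzv ht ih =>
    intro S G hS
    have hzv' : tupVars L z ∩ (D.vars ∪ S.vars) = ∅ := by
      rwa [← tupVars_inter_trans, Set.image_union, ← Decls.vars_trans, ← hS.vars_eq]
    have key := Deriv.substitution (t := fun i => (t i).toGlob) (ih S G hS) hz hzv' (by
      rw [← Set.image_eq_empty (f := AnyVar.trans), Set.image_inter AnyVar.trans_injective,
        Set.image_union, ← Decls.change_trans, ← hS.change_eq, Set.image_iUnion]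
      simpa only [← Expr.vars_trans, RExpr.trans_toGlob] using ht)
    have hG : rtupVars L.trans z ∩ G.trans.vars = ∅ :=
      Set.subset_empty_iff.1 (hzv ▸ Set.inter_subset_inter_right _
        (hS.guard_vars.trans Set.subset_union_right))
    refine key.consequence_trans ?_ ?_ <;>
      simp only [Assn.subst_trans, Sub.many_trans, Assn.trans, Assn.ofExpr_trans, RAssn.subst,
        RAssn.trans_toAssn, RExpr.trans_toGlob, RExpr.subst_many_eq_self _ _ hG]
    · exact fun _ => id
    · exact fun _ => id

end Derivations

/-! ### Translating applications of the recursion rules -/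

section Recursion

variable {Sg : Sig} {L : Lang Sg}

/-- The assumption about the procedure call inside the translation of a method call that corresponds
to an assumption about the method call. -/
def CallSpec.trans (c : CallSpec L) : RCallSpec L.trans where
  pre := .and c.pre.trans (.atom c.s.neNull.trans)
  ts := Ty.obj :: c.ts
  P := TransProc.meth c.m
  t := Tup.cons (F := RExpr L.trans) c.s.trans fun i => (c.t i).trans
  post := c.post.trans

/-- An application of the recursion rule to `S` yields one to every statement related to `S`. For
`μ = spc` the side condition `pᵢ → sᵢ ≠ null` supplies the premise of the failure rule for the
translated calls. -/
theorem RecursionRule.trans {D : Decls L} {μ : Mode} {f : Formula L} (hf : RecursionRule D μ f)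
    (S' : RStmt L.trans) (G : Expr L Scope.prog Ty.bool) (hS : TransRel f.stmt S' G) :
    RRecursionRule D.trans μ ⟨.and f.pre.trans (.atom G.trans), S', f.post.trans⟩ := by
  obtain ⟨A, hf, hbody, hnull⟩ := hf
  have hA : ∀ f ∈ CallSpec.asms A, ∀ S' G, TransRel f.stmt S' G →
      RDeriv D.trans μ (RCallSpec.asms (A.map CallSpec.trans))
        (.and f.pre.trans (.atom G.trans)) S' f.post.trans := by
    rintro _ ⟨c, hc, rfl⟩ S' G hS
    have key : RDeriv D.trans μ (RCallSpec.asms (A.map CallSpec.trans))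
        (.and c.pre.trans (.atom c.s.neNull.trans)) (transCall c.s c.m c.t) c.post.trans :=
      .hyp ⟨c.trans, List.mem_map_of_mem hc, rfl⟩
    obtain ⟨pre, ts, s, m, t, post⟩ := c
    obtain ⟨rfl, rfl⟩ | ⟨_, _, _, _, h, rfl, rfl⟩ := hS
    · cases μ with
      | pc => exact .failure rfl (key.strengthen_pre fun _ h => ⟨h.1.1, h.2⟩)
      | spc =>
        have hs : pre.trans.Implies (.atom s.neNull.trans) := by
          rw [← Assn.ofExpr_trans]
          exact Assn.implies_trans.2 (hnull rfl _ hc)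
        exact .failureII rfl (fun σ h => hs σ h.1)
          (key.strengthen_pre fun σ h => ⟨h.1, hs σ h.1⟩)
    · cases h
      exact key
  refine ⟨A.map CallSpec.trans, hf.trans hA S' G hS, fun c' hc' => ?_⟩
  obtain ⟨c, hc, rfl⟩ := List.mem_map.1 hc'
  obtain ⟨d, hd, hdc⟩ := hbody c hc
  refine ⟨d.trans, congrArg (Option.map Decl.trans) hd, ?_⟩
  have key := hdc.trans hA _ _ (.trans _)
  rw [Decl.inline_trans] at key
  exact key.strengthen_pre fun _ h => ⟨h.1, sat_atom_tt _⟩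

/-- The assumption about a method call that corresponds to an assumption about a procedure call. It
exists only if the arguments of the procedure call are translations of program expressions; no other
procedure call occurs in translated programs and their declarations. -/
def RCallSpec.toCallSpec : RCallSpec L.trans → Option (CallSpec L)
  | ⟨pre, _, .meth m, t, post⟩ =>
    if (fun i => (t i).toProg.trans) = t then
      some ⟨.and pre.toAssn (.ofExpr (Expr.neNull (t 0).toProg)), _, (t 0).toProg, m,
        fun i => (t i.succ).toProg, post.toAssn⟩
    else none

theorem RCallSpec.toCallSpec_transCall (p q : RAssn L.trans) {ts : List Sg.Typ}
    (s : Expr L Scope.prog Ty.obj) (m : L.Meth ts) (t : Tup (Expr L Scope.prog) ts) :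
    RCallSpec.toCallSpec ⟨p, _, TransProc.meth m,
        Tup.cons (F := RExpr L.trans) s.trans fun i => (t i).trans, q⟩ =
      some ⟨.and p.toAssn (.ofExpr s.neNull), ts, s, m, t, q.toAssn⟩ := by
  have hs : RExpr.toProg (Tup.cons (F := RExpr L.trans) s.trans (fun i => (t i).trans)
      (0 : Fin (ts.length + 1))) = s := s.toProg_trans
  have ht : (fun i : Fin ts.length => RExpr.toProg (Tup.cons (F := RExpr L.trans) s.trans
      (fun i => (t i).trans) i.succ)) = t := funext fun i => (t i).toProg_trans
  simp only [RCallSpec.toCallSpec]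
  rw [if_pos]
  · rw [hs, ht]
  · funext i
    exact Fin.cases (congrArg Expr.trans hs) (fun j => congrArg Expr.trans (congrFun ht j)) i

theorem RCallSpec.eq_of_toCallSpec {c : RCallSpec L.trans} {c' : CallSpec L}
    (h : c.toCallSpec = some c') :
    c'.pre = .and c.pre.toAssn (.ofExpr c'.s.neNull) ∧ c'.post = c.post.toAssn ∧
      c = ⟨c.pre, _, TransProc.meth c'.m,
        Tup.cons (F := RExpr L.trans) c'.s.trans fun i => (c'.t i).trans, c.post⟩ := by
  obtain ⟨pre, ts, P, t, post⟩ := c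
  cases P with
  | meth m =>
    simp only [RCallSpec.toCallSpec] at h
    split_ifs at h with ht
    cases h
    refine ⟨rfl, rfl, ?_⟩
    congr 1
    conv_lhs => rw [← ht]
    exact (Tup.cons_head_tail (F := RExpr L.trans) fun i => (t i).toProg.trans).symm

/-- An application of the recursion rule to a statement related to `S` yields one to `S`. As the new
preconditions contain `sᵢ ≠ null`, the side condition for `μ = spc` holds. -/
theorem RRecursionRule.toRecursionRule {D : Decls L} {μ : Mode} {f : RFormula L.trans}
    (hf : RRecursionRule D.trans μ f) (S : Stmt L) (G : Expr L Scope.prog Ty.bool)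
    (hS : TransRel S f.stmt G) :
    RecursionRule D μ ⟨.and f.pre.toAssn (.ofExpr G), S, f.post.toAssn⟩ := by
  obtain ⟨A, hf, hbody⟩ := hf
  -- The assumptions are about procedure calls, which are not translations of statements.
  have hA : ∀ f ∈ RCallSpec.asms A, ∀ S G, TransRel S f.stmt G →
      Deriv D μ (CallSpec.asms (A.filterMap RCallSpec.toCallSpec))
        (.and f.pre.toAssn (.ofExpr G)) S f.post.toAssn := by
    rintro _ ⟨c, hc, rfl⟩ S G hS
    obtain ⟨h, -⟩ | ⟨ts, s, m, t, rfl, h, rfl⟩ := hS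
    · cases S <;> cases h
    · obtain ⟨pre, us, P, t', post⟩ := c
      cases h
      exact .hyp ⟨_, List.mem_filterMap.2
        ⟨_, hc, RCallSpec.toCallSpec_transCall pre post s m t⟩, rfl⟩
  refine ⟨A.filterMap RCallSpec.toCallSpec, hf.toDeriv hA S G hS, ?_, ?_⟩
  · intro c' hc'
    obtain ⟨c, hc, h⟩ := List.mem_filterMap.1 hc'
    obtain ⟨hpre, hpost, hc_eq⟩ := RCallSpec.eq_of_toCallSpec h
    obtain ⟨pre, ts, P, t, post⟩ := c
    cases hc_eq
    obtain ⟨d', hd', hdc⟩ := hbody _ hc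
    obtain ⟨d, hd, rfl⟩ := Option.map_eq_some_iff.1 hd'
    refine ⟨d, hd, ?_⟩
    rw [← Decl.inline_trans] at hdc
    rw [hpre, hpost]
    refine (hdc.toDeriv hA _ _ (.trans _)).consequence_trans (fun _ h => ?_) fun _ => id
    refine ⟨h.1, ?_⟩
    rw [Assn.ofExpr_trans]
    exact sat_atom_tt _
  · intro _ c' hc' σ h
    obtain ⟨c, hc, hcc⟩ := List.mem_filterMap.1 hc'
    rw [(RCallSpec.eq_of_toCallSpec hcc).1] at h
    exact h.2

/-- Derivability is preserved and reflected by the translation, in PO⁺ and PR⁺ as well as in SPO⁺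
and SPR⁺. -/
theorem derivPlus_iff_rDerivPlus_trans (D : Decls L) (μ : Mode) (p : Assn L) (S : Stmt L)
    (q : Assn L) : DerivPlus D μ p S q ↔ RDerivPlus D.trans μ p.trans S.trans q.trans := by
  constructor
  · intro h
    have key := Deriv.trans (A' := {f | RRecursionRule D.trans μ f})
      (fun f hf S' G hS => .hyp (RecursionRule.trans hf S' G hS)) h S.trans .tt (.trans S)
    exact key.strengthen_pre fun _ h => ⟨h, sat_atom_tt _⟩
  · intro h
    have key := RDeriv.toDeriv (A := {f | RecursionRule D μ f})
      (fun f hf S G hS => .hyp (RRecursionRule.toRecursionRule hf S G hS)) h S .tt (.trans S)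
    refine key.consequence_trans ?_ ?_ <;>
      simp only [Assn.trans, RAssn.trans_toAssn, Assn.ofExpr_trans]
    · exact fun _ h => ⟨h, sat_atom_tt _⟩
    · exact fun _ => id

end Recursion

/-! ### Translating computations -/

section Computations

variable {Sg : Sig} {L : Lang Sg}

/-- All methods called in the statement are declared in `D`. In contrast to `IsProgram`, this holds
for the block statement that a call amounts to as well, which declares `this` local. -/
def Stmt.CallsDeclared (D : Decls L) : Stmt L → Prop
  | .seq S₁ S₂ => S₁.CallsDeclared D ∧ S₂.CallsDeclared D
  | .ite _ S₁ S₂ => S₁.CallsDeclared D ∧ S₂.CallsDeclared D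
  | .fail _ S => S.CallsDeclared D
  | .while _ S => S.CallsDeclared D
  | .block _ _ S => S.CallsDeclared D
  | .call _ m _ => (D m).isSome = true
  | _ => True

theorem Stmt.IsProgram.callsDeclared {D : Decls L} :
    ∀ {S : Stmt L}, S.IsProgram D → S.CallsDeclared D
  | .seq _ _, h => ⟨h.1.callsDeclared, h.2.callsDeclared⟩
  | .ite _ _ _, h => ⟨h.1.callsDeclared, h.2.callsDeclared⟩
  | .fail _ S, h => callsDeclared (S := S) h
  | .while _ S, h => callsDeclared (S := S) h
  | .block _ _ _, h => h.2.callsDeclared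
  | .call _ _ _, h => h
  | .skip, _ => trivial
  | .assign _ _, _ => trivial
  | .passign _ _, _ => trivial

theorem Exec.trans {D : Decls L} {S : Stmt L} {σ : State L} {r : Option (State L)}
    (h : Exec D S σ r) : RExec D.trans S.trans σ.trans (r.map State.trans) := by
  induction h with
  | skip σ => exact .skip _
  | assign σ u t =>
    have := RExec.assign (D := D.trans) σ.trans u.trans t.trans
    rwa [Expr.eval_trans, ← State.set_trans] at this
  | passign σ x t =>
    have := RExec.passign (D := D.trans) σ.trans x fun i => (t i).trans
    simp only [Expr.eval_trans, ← State.setVars_trans] at this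
    exact this
  | seq _ _ ih₁ ih₂ => exact .seq ih₁ ih₂
  | seq_fail _ ih => exact .seq_fail ih
  | ite_true hB _ ih => exact .ite_true ((Expr.isTrue_trans _ _).2 hB) ih
  | ite_false hB _ ih => exact .ite_false (mt (Expr.isTrue_trans _ _).1 hB) ih
  | fail_true hB _ ih => exact .fail_true ((Expr.isTrue_trans _ _).2 hB) ih
  | fail_false hB => exact .fail_false (mt (Expr.isTrue_trans _ _).1 hB)
  | while_true hB _ ih => exact .while_true ((Expr.isTrue_trans _ _).2 hB) ih
  | while_false hB => exact .while_false (mt (Expr.isTrue_trans _ _).1 hB)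
  | block _ ih => exact .block ih
  | block_fail _ ih => exact .block_fail ih
  | @call ts s m t d σ r hd _ ih =>
    have hd' : D.trans (TransProc.meth m) = some d.trans := congrArg (Option.map Decl.trans) hd
    rw [Stmt.trans, Decl.inline_trans] at ih
    generalize r.map State.trans = r' at ih ⊢
    cases ih with
    | fail_true hB h => exact .fail_true hB (.call hd' h)
    | fail_false hB => exact .fail_false hB

/-- Every computation of a translated program comes from one of the object-oriented program. Methods
have to be declared, since a call of an undeclared method on `null` has no computation, while its
translation fails. -/
theorem RExec.exists_exec {D : Decls L} (hD : D.WellFormed) {S' : RStmt L.trans}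
    {σ' : RState L.trans} {r' : Option (RState L.trans)} (h : RExec D.trans S' σ' r') :
    ∀ (S : Stmt L) (G : Expr L Scope.prog Ty.bool) (σ : State L), TransRel S S' G →
      S.CallsDeclared D → σ.trans = σ' → G.IsTrue σ →
      ∃ r, r' = r.map State.trans ∧ Exec D S σ r := by
  induction h with
  | skip _ =>
    rintro S _ σ (⟨h, rfl⟩ | ⟨_, _, _, _, -, h, -⟩) hS rfl -
    · cases S <;> cases h
      exact ⟨some σ, rfl, .skip σ⟩
    · cases h
  | assign _ u t =>
    rintro S _ σ (⟨h, rfl⟩ | ⟨_, _, _, _, -, h, -⟩) hS rfl -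
    · cases S <;> cases h
      refine ⟨_, ?_, .assign σ _ _⟩
      rw [Expr.eval_trans, ← State.set_trans]
      rfl
    · cases h
  | passign _ x t =>
    rintro S _ σ (⟨h, rfl⟩ | ⟨_, _, _, _, -, h, -⟩) hS rfl -
    · cases S <;> cases h
      refine ⟨_, ?_, .passign σ _ _⟩
      simp only [Expr.eval_trans, ← State.setVars_trans]
      rfl
    · cases h
  | seq _ _ ih₁ ih₂ =>
    rintro S _ σ (⟨h, rfl⟩ | ⟨_, _, _, _, -, h, -⟩) hS rfl -
    · cases S <;> cases h
      obtain ⟨r₁, hr₁, h₁⟩ := ih₁ _ _ σ (.trans _) hS.1 rfl rfl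
      obtain ⟨τ, rfl, hτ⟩ := Option.map_eq_some_iff.1 hr₁.symm
      obtain ⟨r, hr, h₂⟩ := ih₂ _ _ τ (.trans _) hS.2 hτ rfl
      exact ⟨r, hr, .seq h₁ h₂⟩
    · cases h
  | seq_fail _ ih =>
    rintro S _ σ (⟨h, rfl⟩ | ⟨_, _, _, _, -, h, -⟩) hS rfl -
    · cases S <;> cases h
      obtain ⟨r, hr, h⟩ := ih _ _ σ (.trans _) hS.1 rfl rfl
      obtain rfl := Option.map_eq_none_iff.1 hr.symm
      exact ⟨none, rfl, .seq_fail h⟩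
    · cases h
  | ite_true hB _ ih =>
    rintro S _ σ (⟨h, rfl⟩ | ⟨_, _, _, _, -, h, -⟩) hS rfl -
    · cases S <;> cases h
      obtain ⟨r, hr, h⟩ := ih _ _ σ (.trans _) hS.1 rfl rfl
      exact ⟨r, hr, .ite_true ((Expr.isTrue_trans _ _).1 hB) h⟩
    · cases h
  | ite_false hB _ ih =>
    rintro S _ σ (⟨h, rfl⟩ | ⟨_, _, _, _, -, h, -⟩) hS rfl -
    · cases S <;> cases h
      obtain ⟨r, hr, h⟩ := ih _ _ σ (.trans _) hS.2 rfl rfl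
      exact ⟨r, hr, .ite_false (mt (Expr.isTrue_trans _ _).2 hB) h⟩
    · cases h
  | fail_true hB _ ih =>
    rintro S _ σ (⟨h, rfl⟩ | ⟨_, _, _, _, -, h, -⟩) hS rfl -
    · cases S <;> cases h
      · obtain ⟨r, hr, h⟩ := ih _ _ σ (.trans _) hS rfl rfl
        exact ⟨r, hr, .fail_true ((Expr.isTrue_trans _ _).1 hB) h⟩
      · exact ih _ _ σ (.call _ _ _) hS rfl ((Expr.isTrue_trans (Expr.neNull _) _).1 hB)
    · cases h
  | fail_false hB =>
    rintro S _ σ (⟨h, rfl⟩ | ⟨_, _, _, _, -, h, -⟩) hS rfl -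
    · cases S <;> cases h
      · exact ⟨none, rfl, .fail_false (mt (Expr.isTrue_trans _ _).2 hB)⟩
      · obtain ⟨d, hd⟩ := Option.isSome_iff_exists.1 hS
        exact ⟨none, rfl, .call hd (.fail_false (mt (Expr.isTrue_trans (Expr.neNull _) _).2 hB))⟩
    · cases h
  | while_true hB _ ih =>
    rintro S _ σ (⟨h, rfl⟩ | ⟨_, _, _, _, -, h, -⟩) hS rfl -
    · cases S <;> cases h
      obtain ⟨r, hr, h⟩ := ih (.seq _ (.while _ _)) _ σ (.trans _) ⟨hS, hS⟩ rfl rfl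
      exact ⟨r, hr, .while_true ((Expr.isTrue_trans _ _).1 hB) h⟩
    · cases h
  | while_false hB =>
    rintro S _ σ (⟨h, rfl⟩ | ⟨_, _, _, _, -, h, -⟩) hS rfl -
    · cases S <;> cases h
      exact ⟨some σ, rfl, .while_false (mt (Expr.isTrue_trans _ _).2 hB)⟩
    · cases h
  | block _ ih =>
    rintro S _ σ (⟨h, rfl⟩ | ⟨_, _, _, _, -, h, -⟩) hS rfl -
    · cases S <;> cases h
      obtain ⟨r₁, hr₁, h₁⟩ := ih (.seq (.passign _ _) _) _ σ (.trans _) ⟨trivial, hS⟩ rfl rfl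
      obtain ⟨τ, rfl, rfl⟩ := Option.map_eq_some_iff.1 hr₁.symm
      exact ⟨_, rfl, .block h₁⟩
    · cases h
  | block_fail _ ih =>
    rintro S _ σ (⟨h, rfl⟩ | ⟨_, _, _, _, -, h, -⟩) hS rfl -
    · cases S <;> cases h
      obtain ⟨r, hr, h⟩ := ih (.seq (.passign _ _) _) _ σ (.trans _) ⟨trivial, hS⟩ rfl rfl
      obtain rfl := Option.map_eq_none_iff.1 hr.symm
      exact ⟨none, rfl, .block_fail h⟩
    · cases h
  | call hd' _ ih =>
    rintro S _ σ (⟨h, rfl⟩ | ⟨_, s, m, t, rfl, h, rfl⟩) hS rfl hG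
    · cases S <;> cases h
    · cases h
      obtain ⟨d, hd, rfl⟩ := Option.map_eq_some_iff.1 hd'
      rw [← Decl.inline_trans] at ih
      obtain ⟨r, hr, h⟩ := ih _ _ σ (.trans _) (hD m d hd).2.2.callsDeclared rfl rfl
      exact ⟨r, hr, .call hd (.fail_true hG h)⟩

/-- Truth of correctness formulas is preserved and reflected by the translation. -/
theorem Stmt.IsProgram.valid_iff {D : Decls L} (hD : D.WellFormed) {S : Stmt L}
    (hS : S.IsProgram D) (μ : Mode) (p q : Assn L) :
    Valid D μ p S q ↔ RValid D.trans μ p.trans S.trans q.trans := by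
  have back : ∀ (σ : State L) (r' : Option (RState L.trans)),
      RExec D.trans S.trans σ.trans r' → ∃ r, r' = r.map State.trans ∧ Exec D S σ r :=
    fun σ r' h => h.exists_exec hD S .tt σ (.trans S) hS.callsDeclared rfl rfl
  cases μ with
  | pc =>
    constructor
    · intro h σ τ hp hx
      rw [← σ.trans_toState] at hp hx
      obtain ⟨r, hr, hx'⟩ := back _ _ hx
      obtain ⟨τ, rfl, rfl⟩ := Option.map_eq_some_iff.1 hr.symm
      exact (q.sat_trans τ).2 (h _ τ ((p.sat_trans _).1 hp) hx')
    · intro h σ τ hp hx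
      exact (q.sat_trans τ).1 (h _ _ ((p.sat_trans σ).2 hp) hx.trans)
  | spc =>
    constructor
    · intro h σ r' hp hx
      rw [← σ.trans_toState] at hp hx
      obtain ⟨r, rfl, hx'⟩ := back _ _ hx
      obtain ⟨τ, rfl, hq⟩ := h _ r ((p.sat_trans _).1 hp) hx'
      exact ⟨τ.trans, rfl, (q.sat_trans τ).2 hq⟩
    · intro h σ r hp hx
      obtain ⟨τ', hr, hq⟩ := h _ _ ((p.sat_trans σ).2 hp) hx.trans
      obtain ⟨τ, rfl, rfl⟩ := Option.map_eq_some_iff.1 hr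
      exact ⟨τ, rfl, (q.sat_trans τ).1 hq⟩

theorem soundFor_iff_rSoundFor_trans {D : Decls L} (hD : D.WellFormed) (μ : Mode)
    {C : Set (Stmt L)} (hC : ∀ S ∈ C, S.IsProgram D) :
    SoundFor D μ C ↔ RSoundFor D.trans μ (Stmt.trans '' C) := by
  constructor
  · rintro h _ ⟨S, hS, rfl⟩ p q hd
    rw [← p.trans_toAssn, ← q.trans_toAssn] at hd ⊢
    exact ((hC S hS).valid_iff hD μ _ _).1
      (h S hS _ _ ((derivPlus_iff_rDerivPlus_trans D μ _ S _).2 hd))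
  · intro h S hS p q hd
    exact ((hC S hS).valid_iff hD μ p q).2
      (h _ ⟨S, hS, rfl⟩ _ _ ((derivPlus_iff_rDerivPlus_trans D μ p S q).1 hd))

theorem completeFor_iff_rCompleteFor_trans {D : Decls L} (hD : D.WellFormed) (μ : Mode)
    {C : Set (Stmt L)} (hC : ∀ S ∈ C, S.IsProgram D) :
    CompleteFor D μ C ↔ RCompleteFor D.trans μ (Stmt.trans '' C) := by
  constructor
  · rintro h _ ⟨S, hS, rfl⟩ p q hv
    rw [← p.trans_toAssn, ← q.trans_toAssn] at hv ⊢
    exact (derivPlus_iff_rDerivPlus_trans D μ _ S _).1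
      (h S hS _ _ (((hC S hS).valid_iff hD μ _ _).2 hv))
  · intro h S hS p q hv
    exact (derivPlus_iff_rDerivPlus_trans D μ p S q).2
      (h _ ⟨S, hS, rfl⟩ _ _ (((hC S hS).valid_iff hD μ p q).1 hv))

end Computations

end OOVerif

end

theorem mainTheorem3 (Sg : OOVerif.Sig) (L : OOVerif.Lang Sg) (D : OOVerif.Decls L)
    (hD : D.WellFormed) :
    (∀ (p : OOVerif.Assn L) (S : OOVerif.Stmt L) (q : OOVerif.Assn L), S.IsProgram D →
      (OOVerif.DerivPlus D OOVerif.Mode.pc p S q ↔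
        OOVerif.RDerivPlus D.trans OOVerif.Mode.pc p.trans S.trans q.trans)) ∧
    (∀ (p : OOVerif.Assn L) (S : OOVerif.Stmt L) (q : OOVerif.Assn L), S.IsProgram D →
      (OOVerif.DerivPlus D OOVerif.Mode.spc p S q ↔
        OOVerif.RDerivPlus D.trans OOVerif.Mode.spc p.trans S.trans q.trans)) ∧
    (∀ (μ : OOVerif.Mode) (C : Set (OOVerif.Stmt L)), (∀ S ∈ C, S.IsProgram D) →
      (OOVerif.SoundFor D μ C ↔ OOVerif.RSoundFor D.trans μ (OOVerif.Stmt.trans '' C)) ∧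
      (OOVerif.CompleteFor D μ C ↔
        OOVerif.RCompleteFor D.trans μ (OOVerif.Stmt.trans '' C))) :=
  ⟨fun p S q _ => OOVerif.derivPlus_iff_rDerivPlus_trans D _ p S q,
    fun p S q _ => OOVerif.derivPlus_iff_rDerivPlus_trans D _ p S q,
    fun μ _ hC => ⟨OOVerif.soundFor_iff_rSoundFor_trans hD μ hC,
      OOVerif.completeFor_iff_rCompleteFor_trans hD μ hC⟩⟩
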